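/- Let $F$ be a field of characteristic $0$ and $M$ an additive subgroup of $F$. Let $\mathrm{Vir}[M]$ be the Lie algebra with basis $\{L_\mu,c\mid\mu\in M\}$, where $c$ is central and $$[L_\mu,L_\nu]=(\nu-\mu)L_{\mu+\nu}+\tfrac1{12}(\mu^3-\mu)\delta_{\mu+\nu,0}\,c .$$ A module of the intermediate series over $\mathrm{Vir}[M]$ is an indecomposable module $V=\bigoplus_{\lambda\in F}V_\lambda$, $V_\lambda=\{v\in V\mid L_0v=\lambda v\}$, with $\dim V_\lambda\le 1$ for all $\lambda\in F$. For a subgroup $M'$ of $F$ and $\alpha\in F$ with $2\alpha\in M'$, let $\widetilde{\mathrm S}\mathrm{Vir}[M',\alpha]$ and $\mathrm{SVir}[M',\alpha]$ be the Lie superalgebras with even basis $\{L_\mu,c\mid\mu\in M'\}$ and odd basis $\{G_\nu\mid\nu\in\alpha+M'\}$, with the brackets of $\mathrm{Vir}[M']$ on the even part, $[c,G_\nu]=0$, and $$\widetilde{\mathrm S}\mathrm{Vir}[M',\alpha]:\quad [L_\mu,G_\nu]=(\nu+\tfrac12\mu)G_{\mu+\nu},\qquad [G_\nu,G_\kappa]=\delta_{\nu+\kappa,0}\,c,$$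 $$\mathrm{SVir}[M',\alpha]:\quad [L_\mu,G_\nu]=(\nu-\tfrac12\mu)G_{\mu+\nu},\qquad [G_\nu,G_\kappa]=2L_{\nu+\kappa}-\tfrac13(\nu^2-\tfrac14)\delta_{\nu+\kappa,0}\,c .$$ **Lemma 5.1.** Let $W=W_{\bar0}\oplus W_{\bar1}$ be a Lie superalgebra over $F$ with $[W_{\bar1},W_{\bar1}]\ne0$ such that $W_{\bar0}\simeq\mathrm{Vir}[M]$ and $W_{\bar1}$ is, through this isomorphism, a nontrivial irreducible $\mathrm{Vir}[M]$-module of the intermediate series (nontrivial: $\mathrm{Vir}[M]$ does not act by zero). Then $W$ is isomorphic, as a Lie superalgebra, to $\widetilde{\mathrm S}\mathrm{Vir}[M',\alpha]$ or to $\mathrm{SVir}[M',\alpha]$ for some $\alpha\in F$ with $2\alpha\in M'$, where $M'=M$ or $M'=aM$ for some $a\in F$ that is not a square in $F$. (In particular $M'=M$ if every element of $F$ is a square; in general $\mathrm{Vir}[aM]\simeq\mathrm{Vir}[M]$.) -/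

import Mathlib

/-- A Lie superalgebra structure on the `F`-vector space `W`: a `ℤ/2ℤ`-grading `W = W₀ ⊕ W₁` and an
even bilinear bracket which satisfies super skew-symmetry and the super Jacobi identity. -/
structure LieSuperalgebra (F W : Type*) [Field F] [AddCommGroup W] [Module F W] where
  part : ZMod 2 → Submodule F W
  isCompl : IsCompl (part 0) (part 1)
  bracket : W →ₗ[F] W →ₗ[F] W
  bracket_mem : ∀ (i j : ZMod 2) (x y : W), x ∈ part i → y ∈ part j → bracket x y ∈ part (i + j)
  skew : ∀ (i j : ZMod 2) (x y : W), x ∈ part i → y ∈ part j →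
    bracket x y = -((-1 : F) ^ (i.val * j.val) • bracket y x)
  jacobi : ∀ (i j : ZMod 2) (x y z : W), x ∈ part i → y ∈ part j →
    bracket x (bracket y z) =
      bracket (bracket x y) z + (-1 : F) ^ (i.val * j.val) • bracket y (bracket x z)

theorem eq_zero_of_eq_neg_self (F : Type*) {V : Type*} [Field F] [CharZero F] [AddCommGroup V]
    [Module F V] {v : V} (h : v = -v) : v = 0 := by
  have h2 : (2 : F) • v = 0 := by
    rw [two_smul]
    nth_rewrite 1 [h]
    exact neg_add_cancel v
  exact (smul_eq_zero.mp h2).resolve_left two_ne_zero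

namespace LieSuperalgebra

variable {F W W' : Type*} [Field F] [AddCommGroup W] [Module F W] [AddCommGroup W'] [Module F W']

/-- Two Lie superalgebras are isomorphic: there is a linear bijection which preserves the parity
and the bracket. -/
def Iso (S : LieSuperalgebra F W) (S' : LieSuperalgebra F W') : Prop :=
  ∃ φ : W ≃ₗ[F] W', (∀ (i : ZMod 2), ∀ x ∈ S.part i, φ x ∈ S'.part i) ∧
    ∀ x y : W, φ (S.bracket x y) = S'.bracket (φ x) (φ y)

/-- The even part is a Lie algebra. -/
instance [CharZero F] (S : LieSuperalgebra F W) : LieRing (S.part 0) where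
  bracket x y := ⟨S.bracket x y, by simpa using S.bracket_mem 0 0 x y x.2 y.2⟩
  add_lie x y z := Subtype.ext (by simp)
  lie_add x y z := Subtype.ext (by simp)
  lie_self x := Subtype.ext (by
    have h := S.skew 0 0 x x x.2 x.2
    simp only [ZMod.val_zero, mul_zero, pow_zero, one_smul] at h
    exact eq_zero_of_eq_neg_self F h)
  leibniz_lie x y z := Subtype.ext (by
    have h := S.jacobi 0 0 x y z x.2 y.2
    simp only [ZMod.val_zero, mul_zero, pow_zero, one_smul] at h
    exact h)

instance [CharZero F] (S : LieSuperalgebra F W) : LieAlgebra F (S.part 0) where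
  lie_smul t x y := Subtype.ext ((S.bracket (x : W)).map_smul t (y : W))

/-- The odd part is a module over the even part. -/
instance [CharZero F] (S : LieSuperalgebra F W) : LieRingModule (S.part 0) (S.part 1) where
  bracket x y := ⟨S.bracket x y, by simpa using S.bracket_mem 0 1 x y x.2 y.2⟩
  add_lie x y z := Subtype.ext (by simp)
  lie_add x y z := Subtype.ext (by simp)
  leibniz_lie x y z := Subtype.ext (by
    have h := S.jacobi 0 0 x y z x.2 y.2
    simp only [ZMod.val_zero, mul_zero, pow_zero, one_smul] at h
    exact h)

instance [CharZero F] (S : LieSuperalgebra F W) : LieModule F (S.part 0) (S.part 1) where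
  smul_lie t x y := Subtype.ext (by
    change S.bracket (t • (x : W)) y = t • S.bracket x y
    simp)
  lie_smul t x y := Subtype.ext ((S.bracket (x : W)).map_smul t (y : W))

/-- The odd part of a Lie superalgebra, as a module over a Lie algebra `L` which is identified with
the even part by an isomorphism `e`. -/
def OddModule [CharZero F] {L : Type*} [LieRing L] [LieAlgebra F L] (S : LieSuperalgebra F W)
    (_e : L ≃ₗ⁅F⁆ S.part 0) : Type _ := S.part 1

section OddModule

variable [CharZero F] {L : Type*} [LieRing L] [LieAlgebra F L] (S : LieSuperalgebra F W)
  (e : L ≃ₗ⁅F⁆ S.part 0)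

instance : AddCommGroup (S.OddModule e) := inferInstanceAs (AddCommGroup (S.part 1))

instance : Module F (S.OddModule e) := inferInstanceAs (Module F (S.part 1))

instance : LieRingModule L (S.OddModule e) :=
  LieRingModule.compLieHom (S.part 1) (e : L →ₗ⁅F⁆ S.part 0)

instance : LieModule F L (S.OddModule e) :=
  LieModule.compLieHom (S.part 1) (e : L →ₗ⁅F⁆ S.part 0)

end OddModule

/-- The bilinear extension of a product of basis elements to the vector space with basis `I`. -/
noncomputable def basisBracket {F I : Type*} [Field F] (br : I → I → I →₀ F) :
    (I →₀ F) →ₗ[F] (I →₀ F) →ₗ[F] (I →₀ F) :=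
  Finsupp.linearCombination F fun i => Finsupp.linearCombination F (br i)

theorem basisBracket_single {F I : Type*} [Field F] (br : I → I → I →₀ F) (i j : I)
    (s t : F) : basisBracket br (Finsupp.single i s) (Finsupp.single j t) = (s * t) • br i j := by
  simp [basisBracket, Finsupp.linearCombination_single, mul_smul]

theorem single_comb {F I : Type*} [Field F] {i j k : I} {a b d : F} (hj : j = i) (hk : k = i)
    (h : a = b + d) :
    Finsupp.single i a = Finsupp.single j b + Finsupp.single k d := by
  rw [hj, hk, h, Finsupp.single_add]

theorem ite_comb {F I : Type*} [Field F] {i j k c : I} {a b d : F} {A B C : Prop} {_ : Decidable A}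
    {_ : Decidable B} {_ : Decidable C} {p q r u v w : F} (hj : j = i) (hk : k = i)
    (h : a = b + d) (hB : B ↔ A) (hC : C ↔ A) (h2 : A → p * u = q * v + r * w) :
    Finsupp.single i a + Finsupp.single c (p * if A then u else 0) =
      (Finsupp.single j b + Finsupp.single c (q * if B then v else 0)) +
      (Finsupp.single k d + Finsupp.single c (r * if C then w else 0)) := by
  rw [add_add_add_comm, ← single_comb hj hk h, ← Finsupp.single_add]
  congr 2
  by_cases hA : A
  · rw [if_pos hA, if_pos (hB.2 hA), if_pos (hC.2 hA), h2 hA]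
  · rw [if_neg hA, if_neg (fun h => hA (hB.1 h)), if_neg (fun h => hA (hC.1 h))]
    simp

/-- The Lie superalgebra with a homogeneous basis `I`, of parities `p`, and brackets `br` of basis
elements. -/
noncomputable def ofBasis {F I : Type*} [Field F] (p : I → ZMod 2) (br : I → I → I →₀ F)
    (hmem : ∀ i j, br i j ∈ Finsupp.supported F F {k | p k = p i + p j})
    (hskew : ∀ i j, br i j = -((-1 : F) ^ ((p i).val * (p j).val) • br j i))
    (hjac : ∀ i j k, basisBracket br (Finsupp.single i 1) (br j k) =
      basisBracket br (br i j) (Finsupp.single k 1) +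
        (-1 : F) ^ ((p i).val * (p j).val) • basisBracket br (Finsupp.single j 1) (br i k)) :
    LieSuperalgebra F (I →₀ F) where
  part i := Finsupp.supported F F {k | p k = i}
  isCompl := by
    constructor
    · apply Finsupp.disjoint_supported_supported
      rw [Set.disjoint_left]
      intro k h0 h1
      simp only [Set.mem_ofPred_eq] at h0 h1
      rw [h0] at h1
      exact absurd h1 (by decide)
    · apply Finsupp.codisjoint_supported_supported
      rw [codisjoint_iff_le_sup]
      intro k _
      simp only [Set.sup_eq_union, Set.mem_union, Set.mem_ofPred_eq]
      generalize p k = q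
      revert q
      decide
  bracket := basisBracket br
  bracket_mem i j x y hx hy := by
    rw [Finsupp.supported_eq_span_single] at hx hy
    induction hx using Submodule.span_induction with
    | zero => simp
    | add a b _ _ ha hb => rw [map_add]; exact add_mem ha hb
    | smul t a _ ha => rw [map_smul]; exact Submodule.smul_mem _ t ha
    | mem a ha =>
      obtain ⟨k, hk, rfl⟩ := ha
      induction hy using Submodule.span_induction with
      | zero => simp
      | add a b _ _ ha hb => rw [map_add]; exact add_mem ha hb
      | smul t a _ ha => rw [map_smul]; exact Submodule.smul_mem _ t ha
      | mem b hb =>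
        obtain ⟨l, hl, rfl⟩ := hb
        simp only [Set.mem_ofPred_eq] at hk hl
        subst hk hl
        simp only [basisBracket_single, mul_one, one_smul]
        exact hmem k l
  skew i j x y hx hy := by
    rw [Finsupp.supported_eq_span_single] at hx hy
    induction hx using Submodule.span_induction with
    | zero => simp
    | add a b _ _ ha hb => simp only [map_add, LinearMap.add_apply, ha, hb, smul_add, neg_add]
    | smul t a _ ha =>
      simp only [map_smul, LinearMap.smul_apply, ha, smul_neg]
      rw [smul_comm]
    | mem a ha =>
      obtain ⟨k, hk, rfl⟩ := ha
      induction hy using Submodule.span_induction with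
      | zero => simp
      | add a b _ _ ha hb => simp only [map_add, LinearMap.add_apply, ha, hb, smul_add, neg_add]
      | smul t a _ ha =>
        simp only [map_smul, LinearMap.smul_apply, ha, smul_neg]
        rw [smul_comm]
      | mem b hb =>
        obtain ⟨l, hl, rfl⟩ := hb
        simp only [Set.mem_ofPred_eq] at hk hl
        subst hk hl
        simp only [basisBracket_single, mul_one, one_smul]
        exact hskew k l
  jacobi i j x y z hx hy := by
    rw [Finsupp.supported_eq_span_single] at hx hy
    induction hx using Submodule.span_induction with
    | zero => simp
    | add a b _ _ ha hb =>
      simp only [map_add, LinearMap.add_apply, ha, hb, smul_add]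
      abel
    | smul t a _ ha =>
      simp only [map_smul, LinearMap.smul_apply, ha, smul_add]
      rw [smul_comm t]
    | mem a ha =>
      obtain ⟨k, hk, rfl⟩ := ha
      induction hy using Submodule.span_induction with
      | zero => simp
      | add a b _ _ ha hb =>
        simp only [map_add, LinearMap.add_apply, ha, hb, smul_add]
        abel
      | smul t a _ ha =>
        simp only [map_smul, LinearMap.smul_apply, ha, smul_add]
        rw [smul_comm t]
      | mem b hb =>
        obtain ⟨l, hl, rfl⟩ := hb
        simp only [Set.mem_ofPred_eq] at hk hl
        subst hk hl
        induction z using Finsupp.induction_linear with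
        | zero => simp
        | add a b ha hb =>
          simp only [map_add, ha, hb, smul_add]
          abel
        | single m t =>
          have h := congrArg (t • ·) (hjac k l m)
          have e : Finsupp.single m t = t • Finsupp.single m (1 : F) := by simp
          rw [e]
          simp only [map_smul, basisBracket_single, one_mul, one_smul, smul_add] at h ⊢
          rw [h, smul_comm t]

end LieSuperalgebra

/-- The index set of the basis `{L_μ, c | μ ∈ M}`. -/
inductive VirIndex {F : Type*} [Field F] (M : AddSubgroup F) where
  | L (μ : M)
  | c

/-- The generalized Virasoro algebra `Vir[M]`, as the vector space with basis `{L_μ, c | μ ∈ M}`. -/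
def Vir {F : Type*} [Field F] (M : AddSubgroup F) : Type _ := VirIndex M →₀ F

namespace Vir

variable {F : Type*} [Field F] (M : AddSubgroup F)

noncomputable instance : AddCommGroup (Vir M) := inferInstanceAs (AddCommGroup (VirIndex M →₀ F))

noncomputable instance : Module F (Vir M) := inferInstanceAs (Module F (VirIndex M →₀ F))

open Classical in
/-- `[L_μ, L_ν] = (ν - μ) L_{μ+ν} + (μ³ - μ)/12 δ_{μ+ν,0} c`, and `c` is central. -/
noncomputable def br : VirIndex M → VirIndex M → VirIndex M →₀ F
  | .L μ, .L ν => Finsupp.single (.L (μ + ν)) ((ν : F) - μ) +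
      Finsupp.single .c (if (μ : F) + ν = 0 then ((μ : F) ^ 3 - μ) / 12 else 0)
  | _, _ => 0

/-- The basis element `L_μ`. -/
noncomputable def L (μ : M) : Vir M := (Finsupp.single (.L μ) 1 : VirIndex M →₀ F)

theorem br_skew (i j : VirIndex M) : br M i j = -br M j i := by
  cases i <;> cases j <;> simp only [br, neg_zero, neg_add, ← Finsupp.single_neg]
  rename_i μ ν
  rw [add_comm ν μ, add_comm (ν : F) μ]
  congr 2
  · ring
  · split_ifs with h
    · have : (ν : F) = -μ := by linear_combination h
      rw [this]; ring
    · simp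

theorem br_jacobi (i j k : VirIndex M) :
    LieSuperalgebra.basisBracket (br M) (Finsupp.single i 1) (br M j k) =
      LieSuperalgebra.basisBracket (br M) (br M i j) (Finsupp.single k 1) +
        LieSuperalgebra.basisBracket (br M) (Finsupp.single j 1) (br M i k) := by
  cases i <;> cases j <;> cases k <;>
    simp only [br, map_add, map_zero, LinearMap.add_apply, LinearMap.zero_apply, smul_zero,
      LieSuperalgebra.basisBracket_single, add_zero, one_mul, mul_one, smul_add,
      Finsupp.smul_single, smul_eq_mul]
  rename_i μ ν l
  refine LieSuperalgebra.ite_comb (congrArg _ (by abel)) (congrArg _ (by abel)) ?_ ?_ ?_ ?_ <;>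
    push_cast
  · ring
  · rw [add_assoc]
  · rw [add_left_comm]
  · intro h
    have : (l : F) = -μ - ν := by linear_combination h
    rw [this]; ring

/-- `Vir[M]` as a Lie superalgebra without odd elements. -/
noncomputable def asSuper : LieSuperalgebra F (VirIndex M →₀ F) :=
  LieSuperalgebra.ofBasis (fun _ => 0) (br M)
    (fun i j => by simp)
    (fun i j => by simpa using br_skew M i j)
    (fun i j k => by simpa using br_jacobi M i j k)

theorem mem_part_zero (x : VirIndex M →₀ F) : x ∈ (asSuper M).part 0 := by
  simp [asSuper, LieSuperalgebra.ofBasis]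

variable [CharZero F]

noncomputable instance : LieRing (Vir M) where
  bracket x y := LieSuperalgebra.basisBracket (br M) x y
  add_lie x y z := (asSuper M).bracket.map_add₂ x y z
  lie_add x y z := map_add ((asSuper M).bracket x) y z
  lie_self x := eq_zero_of_eq_neg_self F (by
    have h := (asSuper M).skew 0 0 x x (mem_part_zero M x) (mem_part_zero M x)
    simp only [ZMod.val_zero, mul_zero, pow_zero, one_smul] at h
    exact h)
  leibniz_lie x y z := by
    have h := (asSuper M).jacobi 0 0 x y z (mem_part_zero M x) (mem_part_zero M y)
    simp only [ZMod.val_zero, mul_zero, pow_zero, one_smul] at h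
    exact h

noncomputable instance : LieAlgebra F (Vir M) where
  lie_smul t x y := map_smul ((asSuper M).bracket x) t y

end Vir

/-- A module of the intermediate series over `Vir[M]`: an indecomposable module which is the sum of
its weight spaces `V_λ = {v | L₀ v = λ v}`, `λ ∈ F`, all of them of dimension at most one. -/
structure IsIntermediateSeries {F : Type*} [Field F] [CharZero F] (M : AddSubgroup F) (V : Type*)
    [AddCommGroup V] [Module F V] [LieRingModule (Vir M) V] [LieModule F (Vir M) V] : Prop where
  iSup_weight : ⨆ l : F, (LieModule.toEnd F (Vir M) V (Vir.L M 0)).eigenspace l = ⊤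
  rank_weight : ∀ l : F,
    Module.rank F ((LieModule.toEnd F (Vir M) V (Vir.L M 0)).eigenspace l) ≤ 1
  nontrivial : Nontrivial V
  indecomposable : ∀ N N' : LieSubmodule F (Vir M) V, IsCompl N N' → N = ⊥ ∨ N' = ⊥

/-- The index set of the basis `{L_μ, c, G_ν | μ ∈ M, ν ∈ α + M}`. -/
inductive SVirIndex {F : Type*} [Field F] (M : AddSubgroup F) (α : F) where
  | L (μ : M)
  | c
  | G (ν : {ν : F // ν - α ∈ M})

namespace SVir

variable {F : Type*} [Field F] (M : AddSubgroup F) (α : F)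

def parity : SVirIndex M α → ZMod 2
  | .L _ => 0
  | .c => 0
  | .G _ => 1

variable {M α}

/-- The index `μ + ν ∈ α + M` for `μ ∈ M` and `ν ∈ α + M`. -/
def addG (μ : M) (ν : {ν : F // ν - α ∈ M}) : {ν : F // ν - α ∈ M} :=
  ⟨μ + ν, by rw [add_sub_assoc]; exact M.add_mem μ.2 ν.2⟩

/-- The index `ν + κ ∈ M` for `ν, κ ∈ α + M`, where `2α ∈ M`. -/
def addGG (hα : 2 * α ∈ M) (ν κ : {ν : F // ν - α ∈ M}) : M :=
  ⟨ν + κ, by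
    have h := M.add_mem (M.add_mem ν.2 κ.2) hα
    have e : (ν : F) + κ = (ν - α) + (κ - α) + 2 * α := by ring
    rw [e]; exact h⟩

open Classical in
/-- The brackets of `Vir[M]` together with `[L_μ, G_ν] = (ν + b μ) G_{μ+ν}`, `[c, G_ν] = 0` and
`[G_ν, G_κ] = x L_{ν+κ} + y(ν) δ_{ν+κ,0} c`. -/
noncomputable def br (hα : 2 * α ∈ M) (b x : F) (y : F → F) :
    SVirIndex M α → SVirIndex M α → SVirIndex M α →₀ F
  | .L μ, .L ν => Finsupp.single (.L (μ + ν)) ((ν : F) - μ) +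
      Finsupp.single .c (if (μ : F) + ν = 0 then ((μ : F) ^ 3 - μ) / 12 else 0)
  | .L μ, .G ν => Finsupp.single (.G (addG μ ν)) ((ν : F) + b * μ)
  | .G ν, .L μ => Finsupp.single (.G (addG μ ν)) (-((ν : F) + b * μ))
  | .G ν, .G κ => Finsupp.single (.L (addGG hα ν κ)) x +
      Finsupp.single .c (if (ν : F) + κ = 0 then y ν else 0)
  | .c, _ => 0
  | _, .c => 0

theorem br_mem (hα : 2 * α ∈ M) (b x : F) (y : F → F) (i j : SVirIndex M α) :
    br hα b x y i j ∈ Finsupp.supported F F {k | parity M α k = parity M α i + parity M α j} := by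
  cases i <;> cases j <;> simp only [br, parity] <;>
    first
    | exact Submodule.zero_mem _
    | exact Finsupp.single_mem_supported F _ (by simp)
    | exact Submodule.add_mem _ (Finsupp.single_mem_supported F _ (by simp; try decide))
        (Finsupp.single_mem_supported F _ (by simp; try decide))

theorem br_skew (hα : 2 * α ∈ M) (b x : F) (y : F → F) (hy : ∀ ν, y (-ν) = y ν)
    (i j : SVirIndex M α) :
    br hα b x y i j =
      -((-1 : F) ^ ((parity M α i).val * (parity M α j).val) • br hα b x y j i) := by
  have h1 : (1 : ZMod 2).val = 1 := rfl
  cases i <;> cases j <;> simp only [br, parity, ZMod.val_zero, h1, mul_zero, mul_one,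
    pow_zero, pow_one, one_smul, neg_smul, neg_neg, smul_zero, neg_zero, ← Finsupp.single_neg]
  · rename_i μ ν
    rw [add_comm ν μ, add_comm (ν : F) μ, neg_add, ← Finsupp.single_neg, ← Finsupp.single_neg]
    congr 2
    · ring
    · split_ifs with h
      · have : (ν : F) = -μ := by linear_combination h
        rw [this]; ring
      · simp
  · rename_i μ ν
    have h : addGG hα μ ν = addGG hα ν μ := Subtype.ext (add_comm _ _)
    rw [h, add_comm (μ : F) ν]
    congr 2
    split_ifs with h
    · have : (ν : F) = -μ := by linear_combination h
      rw [this, hy]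
    · rfl

theorem br_jacobi (hα : 2 * α ∈ M) (b x : F) (y : F → F) (hy : ∀ ν, y (-ν) = y ν)
    (hx : x * (2 * b + 1) = 0)
    (hxy : ∀ μ ν : F, (μ - (μ + ν) * b) * y ν + (ν - (μ + ν) * b) * y μ =
      x * ((μ + ν) - (μ + ν) ^ 3) / 12)
    (i j k : SVirIndex M α) :
    LieSuperalgebra.basisBracket (br hα b x y) (Finsupp.single i 1) (br hα b x y j k) =
      LieSuperalgebra.basisBracket (br hα b x y) (br hα b x y i j) (Finsupp.single k 1) +
        (-1 : F) ^ ((parity M α i).val * (parity M α j).val) •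
          LieSuperalgebra.basisBracket (br hα b x y) (Finsupp.single j 1) (br hα b x y i k) := by
  have h1 : (1 : ZMod 2).val = 1 := rfl
  cases i <;> cases j <;> cases k <;>
    simp only [br, parity, ZMod.val_zero, h1, mul_zero, mul_one, pow_zero, pow_one,
      map_add, map_zero, LinearMap.add_apply, LinearMap.zero_apply, smul_zero,
      LieSuperalgebra.basisBracket_single, add_zero, one_mul, smul_add,
      Finsupp.smul_single, smul_eq_mul]
  · rename_i μ ν l
    refine LieSuperalgebra.ite_comb (congrArg _ (by abel)) (congrArg _ (by abel)) ?_ ?_ ?_ ?_ <;>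
      push_cast
    · ring
    · rw [add_assoc]
    · rw [add_left_comm]
    · intro h
      have : (l : F) = -μ - ν := by linear_combination h
      rw [this]; ring
  · rename_i μ ν l
    refine LieSuperalgebra.single_comb (congrArg _ (Subtype.ext ?_)) (congrArg _ (Subtype.ext ?_))
      ?_ <;> simp only [addG] <;> push_cast <;> ring
  · rename_i μ ν l
    refine LieSuperalgebra.single_comb (congrArg _ (Subtype.ext ?_)) (congrArg _ (Subtype.ext ?_))
      ?_ <;> simp only [addG] <;> push_cast <;> ring
  · rename_i μ ν l
    refine LieSuperalgebra.ite_comb (congrArg _ (Subtype.ext ?_)) (congrArg _ (Subtype.ext ?_))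
      ?_ ?_ ?_ ?_ <;> simp only [addG, addGG] <;> push_cast
    · ring
    · ring
    · linear_combination (-(μ : F)) * hx
    · rw [add_assoc]
    · rw [add_left_comm]
    · intro h
      have e : (μ : F) = -(ν + l) := by linear_combination h
      have e2 : y (μ + ν) = y l := by rw [← hy l, e]; congr 1; ring
      rw [e2, e]
      linear_combination -hxy (ν : F) l
  · rename_i μ ν l
    refine LieSuperalgebra.single_comb (congrArg _ (Subtype.ext ?_)) (congrArg _ (Subtype.ext ?_))
      ?_ <;> simp only [addG] <;> push_cast <;> ring
  · rename_i ν μ l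
    refine LieSuperalgebra.ite_comb (congrArg _ (Subtype.ext ?_)) (congrArg _ (Subtype.ext ?_))
      ?_ ?_ ?_ ?_ <;> simp only [addG, addGG] <;> push_cast
    · ring
    · ring
    · linear_combination (μ : F) * hx
    · rw [add_assoc, add_left_comm]
    · rw [add_left_comm]
    · intro h
      have e : (μ : F) = -(ν + l) := by linear_combination h
      have e2 : y (μ + ν) = y l := by rw [← hy l, e]; congr 1; ring
      rw [e2, e]
      linear_combination hxy (ν : F) l
  · rename_i ν l μ
    rw [← mul_assoc, ← mul_assoc]
    refine LieSuperalgebra.ite_comb (congrArg _ (Subtype.ext ?_)) (congrArg _ (Subtype.ext ?_))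
      ?_ ?_ ?_ ?_ <;> simp only [addG, addGG] <;> push_cast
    · ring
    · ring
    · linear_combination (-(μ : F)) * hx
    · rw [add_assoc, add_comm (l : F)]
    · rw [add_left_comm (l : F), add_left_comm (ν : F), add_comm (l : F)]
    · intro h
      have e : (μ : F) = -(ν + l) := by linear_combination h
      rw [e]
      linear_combination -hxy (ν : F) l
  · rename_i μ ν l
    refine LieSuperalgebra.single_comb (congrArg _ (Subtype.ext ?_)) (congrArg _ (Subtype.ext ?_))
      ?_ <;> simp only [addG, addGG]
    · ring
    · ring
    · linear_combination (-(μ + ν + l : F)) * hx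

/-- The Lie superalgebra with basis `{L_μ, c, G_ν | μ ∈ M, ν ∈ α + M}` and the brackets `br`. -/
noncomputable def ofParameters (hα : 2 * α ∈ M) (b x : F) (y : F → F) (hy : ∀ ν, y (-ν) = y ν)
    (hx : x * (2 * b + 1) = 0)
    (hxy : ∀ μ ν : F, (μ - (μ + ν) * b) * y ν + (ν - (μ + ν) * b) * y μ =
      x * ((μ + ν) - (μ + ν) ^ 3) / 12) : LieSuperalgebra F (SVirIndex M α →₀ F) :=
  LieSuperalgebra.ofBasis (parity M α) (br hα b x y) (br_mem hα b x y) (br_skew hα b x y hy)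
    (br_jacobi hα b x y hy hx hxy)

end SVir

/-- The Lie superalgebra `SVir[M,α]`, with basis `{L_μ, c, G_ν | μ ∈ M, ν ∈ α + M}`, the brackets of
`Vir[M]`, and `[L_μ, G_ν] = (ν - μ/2) G_{μ+ν}`, `[c, G_ν] = 0`,
`[G_ν, G_κ] = 2 L_{ν+κ} - (1/3) (ν² - 1/4) δ_{ν+κ,0} c`. -/
noncomputable def SVir {F : Type*} [Field F] [CharZero F] (M : AddSubgroup F) (α : F)
    (hα : 2 * α ∈ M) : LieSuperalgebra F (SVirIndex M α →₀ F) :=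
  SVir.ofParameters hα (-1 / 2) 2 (fun ν => -(1 / 3) * (ν ^ 2 - 1 / 4)) (fun ν => by ring)
    (by norm_num) (fun μ ν => by ring)

/-- The Lie superalgebra `S̃Vir[M,α]`, with basis `{L_μ, c, G_ν | μ ∈ M, ν ∈ α + M}`, the brackets of
`Vir[M]`, and `[L_μ, G_ν] = (ν + μ/2) G_{μ+ν}`, `[c, G_ν] = 0`, `[G_ν, G_κ] = δ_{ν+κ,0} c`. -/
noncomputable def SVirTilde {F : Type*} [Field F] [CharZero F] (M : AddSubgroup F) (α : F)
    (hα : 2 * α ∈ M) : LieSuperalgebra F (SVirIndex M α →₀ F) :=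
  SVir.ofParameters hα (1 / 2) 0 (fun _ => 1) (fun _ => rfl) (by ring) (fun μ ν => by ring)

/-- The subgroup `a M` of the field `F`. -/
def scaleSubgroup {F : Type*} [Field F] (a : F) (M : AddSubgroup F) : AddSubgroup F :=
  M.map (AddMonoidHom.mulLeft a)

/-!
The odd part `V` carries a symmetric, `Vir[M]`-equivariant bracket `V × V → Vir[M]` for which the
Jacobi identity of three odd elements holds (`Vir.OddBracket`). As `V` is irreducible and this
bracket is not zero, `c` acts on `V` by `0`, and the weights of `V` lie in one coset of `M`. On weight
vectors the bracket consists of two scalar-valued forms: `formL`, the coefficient of `L_μ`, and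
`formC`, the coefficient of `c`. No classification of the modules of the intermediate series is
needed; the brackets determine the module. The one fact about modules with simple weights which is
used throughout is that a nonzero vector of nonzero weight is not annihilated by all of `L_δ`,
`L_{2δ}`, `L_{3δ}`, for `δ ≠ 0` (`Vir.eq_zero_of_highestWeight`).

If `formL = 0`, then `formC` is an invariant nondegenerate form. For a vector `v` of weight `ν ≠ 0` it
implies `L_{-2ν} v = 0` and, with the fact above, `L_μ v ≠ 0` for all other `μ`
(`Vir.OddBracket.lie_ne_zero_of_central`). So the weights of `V` are the `ν + μ`, `μ ∈ M`, and after a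
normalization of the weight vectors the relations leave only one choice for the structure constants
(`halfDensity_structureConstants`), that of `S̃Vir`.

If `formL ≠ 0`, there is a vector `v` of weight `ν ≠ 0` with `formL v v ≠ 0`, and every weight
`ν + μ` occurs, with a vector that pairs with `v` (`Vir.OddBracket.exists_formL_ne_zero`). After the
normalization `formL G_0 G_μ = formL G_0 G_0`, all values `formL G_μ G_κ` agree
(`superVirasoro_structureConstants_eq_one`); this fixes the action of the `L_μ`, and equivariance
yields `formC`, as in `SVir`.

In both cases one factor in the brackets of the odd elements remains. Rescaling the odd elements
changes it by a square. A factor that is not a square is removed by the isomorphism of `Vir[aM]` with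
`Vir[M]`, which sends `L_{aμ}` to `a L_μ`, corrected by a multiple of `c` if `μ = 0`, and `c` to `a⁻¹ c`
(`LieSuperalgebra.iso_ofParameters`).
-/

/-! ### Structure constants of the odd part when the odd bracket involves the `L_μ` -/

section StructureConstants

variable {F A : Type*} [Field F] [CharZero F] [AddCommGroup A]

/-- The constants of `[L_m, G_n] = f(m, n) G_{m+n}` and `[G_m, G_n] = y(m, n) L_{o+m+n}` (up to `c`
and a common factor of the `y`), in the units in which `G_0` has weight `1/2` and `o` is the index
`1`. The vectors `G_n` are normalized by `y(0, n) = 1`; `hder` and `hlie` say that `L_m` acts by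
derivations and that `V` is a module.

The quantity `D(n) = (ι n - 1) (1 - y(-o, n))` is invariant under `n ↦ n + o` and takes only the
values `0` and `-3`. If it were `-3` at `p`, the equations for `y(q, q)` at `q = p, p - o, p - 2o`
would contradict each other. Hence `y(-o, n) = 1`, and a recursion yields `y = 1`. -/
theorem superVirasoro_structureConstants_eq_one {ι : A →+ F} {o : A} (ho : ι o = 1)
    {f y : A → A → F} (hf : ∀ m n, f m n = 1 + ι n - ι m - (1 - ι m) / 2 * y m n)
    (hsymm : ∀ m n, y m n = y n m) (hy0 : ∀ n, y 0 n = 1)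
    (hder : ∀ m n k, f m n * y (m + n) k + f m k * y n (m + k) = y n k * (1 + ι n + ι k - ι m))
    (hlie : ∀ m k n, f k n * f m (n + k) - f m n * f k (n + m) = (ι k - ι m) * f (m + k) n)
    (m n : A) : y m n = 1 := by
  have hder' : ∀ m n k p q, m + n = p → m + k = q →
      f m n * y p k + f m k * y n q = y n k * (1 + ι n + ι k - ι m) := by
    rintro m n k _ _ rfl rfl
    exact hder m n k
  obtain ⟨D, hD⟩ : ∃ D : A → F, ∀ n, D n = (ι n - 1) * (1 - y (-o) n) := ⟨_, fun _ => rfl⟩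
  have hshift : ∀ n, D (n + o) = D n := by
    intro n
    have h := hlie (-o) o n
    have e1 : n + o + -o = n := by abel
    rw [hD, hD]
    simp only [neg_add_cancel, hf, map_add, map_neg, map_zero, ho, hy0] at h ⊢
    linear_combination h
  have hshift' : ∀ n, D (n - o) = D n := fun n => by rw [← hshift (n - o), sub_add_cancel]
  have hint : ∀ (j : ℤ) n, ι n = j → D n = 0 := by
    intro j
    induction j using Int.induction_on with
    | zero =>
      intro n hn
      rw [← hshift n, hD, map_add, ho, hn]
      simp
    | succ i ih =>
      intro n hn
      rw [← hshift']
      exact ih _ (by rw [map_sub, ho, hn]; push_cast; ring)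
    | pred i ih =>
      intro n hn
      rw [← hshift]
      exact ih _ (by rw [map_add, ho, hn]; push_cast; ring)
  have hneg : ∀ m, f m (-o) = -(ι m + 1 + D m) / 2 := by
    intro m
    rw [hf, hsymm m, map_neg, ho, hD]
    ring
  have hone : ∀ n, D n = 0 → ι n ≠ 1 → y (-o) n = 1 := by
    intro n hn hn1
    rw [hD] at hn
    rcases mul_eq_zero.1 hn with h | h
    · exact absurd (sub_eq_zero.1 h) hn1
    · linear_combination -h
  have hoo : y (-o) (-o) = 1 := hone _ (hint (-1) _ (by simp [ho])) (by rw [map_neg, ho]; norm_num)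
  -- The value at the excluded weight comes from `[L_{-1}, L_2] = 3 L_1` applied to `G_{-1/2}`.
  have hone' : ∀ q, ι q = 1 → y (-o) q = 1 := by
    intro q hq
    have h := hlie (-o) (q + o) (-o)
    have e1 : -o + (q + o) = q := by abel
    rw [e1, hneg q, hneg (q + o), hneg (-o), hf (-o) q, hint 2 (q + o) (by simp [ho, hq]; norm_num),
      hint 1 q (by simp [hq]), hint (-1) (-o) (by simp [ho])] at h
    simp only [map_add, map_neg, ho, hq] at h
    linear_combination (2 / 3 : F) * h
  have ho1 : y (-o) o = 1 := hone' o ho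
  have hcase : ∀ n, D n * (D n + 3) = 0 := by
    intro n
    have h := hder' n (-o) (-o) (n - o) (n - o) (by abel) (by abel)
    have h1 := hshift' n
    rw [hD (n - o), map_sub, ho] at h1
    rw [hsymm (n - o), hneg, hoo, map_neg, ho] at h
    linear_combination (ι n - 2) * h - (ι n + 1 + D n) * h1
  have hdiag : ∀ p, ι p ≠ 1 →
      y p p * (ι p + 1) * (ι p - 1) = ((ι p + 1) * (ι p - 1) + D p) * y (p - o) (p - o) := by
    intro p hp
    have hp' : ι p - 1 ≠ 0 := sub_ne_zero.2 hp
    have h1 := hder' (-o) p p (p - o) (p - o) (by abel) (by abel)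
    have h2 := hder' o (p - o) (p - o) p p (by abel) (by abel)
    rw [hf o] at h2
    rw [hf (-o)] at h1
    simp only [map_sub, map_neg, ho] at h1 h2
    have h3 : y p (p - o) = y (p - o) (p - o) := by
      apply mul_left_cancel₀ (mul_ne_zero hp' two_ne_zero)
      rw [hsymm (p - o) p] at h2
      linear_combination h2
    have h4 := hD p
    rw [hsymm (p - o) p, h3] at h1
    linear_combination (-(ι p - 1) / 2) * h1 - y (p - o) (p - o) * h4
  have hanti : ∀ t, (4 + D t + D (-t)) * y t (-t) * ((ι t + 1) * (ι t - 1)) =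
      4 * (ι t + 1) * (ι t - 1) + 2 * D (-t) * (2 * ι t + 1) * (ι t - 1) -
        2 * D t * (1 - 2 * ι t) * (ι t + 1) := by
    intro t
    have h1 := hder' (t + o) (-t) (-o) o t (by abel) (by abel)
    have h2 := hder' (o - t) t (-o) o (-t) (by abel) (by abel)
    have h3 := hder' o t (-t) (t + o) (o - t) (by abel) (by abel)
    have h4 := hshift t
    have h5 := hshift (-t)
    have h6 := hD t
    have h7 := hD (-t)
    rw [show -t + o = o - t by abel] at h5
    rw [hneg, hsymm o, hsymm (-t), hsymm (-t), ho1, hf (t + o), h4] at h1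
    rw [hneg, hsymm o, hsymm t (-o), ho1, hf (o - t), h5, hsymm (o - t)] at h2
    rw [hf o, hf o] at h3
    simp only [map_add, map_sub, map_neg, ho] at h1 h2 h3 h6 h7
    linear_combination ((ι t + 1) * (ι t - 1)) * (-2 * h1 - 2 * h2 + h3) -
      2 * (2 * ι t + 1) * (ι t - 1) * h7 + 2 * (1 - 2 * ι t) * (ι t + 1) * h6
  have hzero : ∀ p, D p = 0 := by
    intro p
    by_contra hp
    have hZ : ∀ j : ℤ, ι p ≠ j := fun j hj => hp (hint j p hj)
    have hDp : D p = -3 := by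
      rcases mul_eq_zero.1 (hcase p) with h | h
      · exact absurd h hp
      · linear_combination h
    have k0 : ι p ≠ 0 := by exact_mod_cast hZ 0
    have k1 : ι p - 1 ≠ 0 := sub_ne_zero.2 (by exact_mod_cast hZ 1)
    have k2 : ι p - 2 ≠ 0 := sub_ne_zero.2 (by exact_mod_cast hZ 2)
    have k3 : ι p - 3 ≠ 0 := sub_ne_zero.2 (by exact_mod_cast hZ 3)
    have l1 : ι p + 1 ≠ 0 := by
      have := hZ (-1)
      intro h
      apply this
      push_cast
      linear_combination h
    have l2 : ι p + 2 ≠ 0 := by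
      have := hZ (-2)
      intro h
      apply this
      push_cast
      linear_combination h
    -- On the coset of `p` all the `y (q, q)` satisfy the same quadratic equation in `q`.
    have hquad : ∀ q, D q = -3 → D (-q) = D (-p) → ι q - 1 ≠ 0 → ι q + 1 ≠ 0 →
        4 * (3 * ι q ^ 2 + ι q - 1) = (1 + D (-p)) * (y q q * (ι q - 1) * (1 + 3 * ι q)) := by
      intro q h1 h2 h3 h4
      have h5 := hanti (-q)
      have h6 := hder' (-q) q q 0 0 (by abel) (by abel)
      rw [neg_neg, h1, h2, map_neg] at h5
      rw [hsymm q 0, hy0, hf, map_neg] at h6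
      rcases mul_eq_zero.1 (hcase (-p)) with h | h
      · rw [h] at h5 ⊢
        apply mul_left_cancel₀ h4
        linear_combination (ι q ^ 2 - 1) * h6 + (ι q + 1) * h5
      · rw [eq_neg_of_add_eq_zero_left h] at h5 ⊢
        apply mul_left_cancel₀ h4
        linear_combination -2 * (ι q ^ 2 - 1) * h6 + (ι q + 1) * h5
    have hD' : (1 + D (-p)) ≠ 0 := by
      intro h
      have h1 := hcase (-p)
      rw [show D (-p) = -1 by linear_combination h] at h1
      norm_num at h1
    -- The values `y (p, p)` on the coset of `p` are `K (p + 2) / (p - 1)`.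
    obtain ⟨K, hK⟩ : ∃ K, y p p * (ι p - 1) = K * (ι p + 2) :=
      ⟨y p p * (ι p - 1) / (ι p + 2), by field_simp⟩
    have hK1 : y (p - o) (p - o) * (ι p - 2) = K * (ι p + 1) := by
      have h := hdiag p (sub_ne_zero.1 k1)
      rw [hDp] at h
      apply mul_left_cancel₀ l2
      linear_combination -h + (ι p + 1) * hK
    have hK2 : y (p - o - o) (p - o - o) * (ι p - 3) = K * ι p := by
      have h := hdiag (p - o) (by rw [map_sub, ho]; intro h; apply k2; linear_combination h)
      rw [hshift', hDp, map_sub, ho] at h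
      apply mul_left_cancel₀ l1
      linear_combination -h + ι p * hK1
    have hp1 : ι (p - o) = ι p - 1 := by rw [map_sub, ho]
    have hp2 : ι (p - o - o) = ι p - 2 := by rw [map_sub, hp1, ho]; ring
    have q0 := hquad p hDp rfl k1 l1
    have q1 := hquad (p - o) (by rw [hshift', hDp])
      (by rw [show -(p - o) = -p + o by abel, hshift])
      (by rw [hp1]; intro h; apply k2; linear_combination h)
      (by rw [hp1]; intro h; apply k0; linear_combination h)
    have q2 := hquad (p - o - o) (by rw [hshift', hshift', hDp])
      (by rw [show -(p - o - o) = -p + o + o by abel, hshift, hshift])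
      (by rw [hp2]; intro h; apply k3; linear_combination h)
      (by rw [hp2]; intro h; apply k1; linear_combination h)
    rw [hp1] at q1
    rw [hp2] at q2
    have r0 : 4 * (3 * ι p ^ 2 + ι p - 1) =
        (1 + D (-p)) * K * (ι p + 2) * (1 + 3 * ι p) := by
      linear_combination q0 + (1 + D (-p)) * (1 + 3 * ι p) * hK
    have r1 : 4 * (3 * (ι p - 1) ^ 2 + (ι p - 1) - 1) =
        (1 + D (-p)) * K * (ι p + 1) * (1 + 3 * (ι p - 1)) := by
      linear_combination q1 + (1 + D (-p)) * (1 + 3 * (ι p - 1)) * hK1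
    have r2 : 4 * (3 * (ι p - 2) ^ 2 + (ι p - 2) - 1) =
        (1 + D (-p)) * K * ι p * (1 + 3 * (ι p - 2)) := by
      linear_combination q2 + (1 + D (-p)) * (1 + 3 * (ι p - 2)) * hK2
    have r3 : (1 + D (-p)) * K = 4 := by linear_combination (-(r0 - 2 * r1 + r2)) / 6
    rw [r3] at r0 r1
    have r4 : (1 : F) = 0 := by linear_combination (r1 - r0) / 24
    exact one_ne_zero r4
  have hm1 : ∀ q, y (-o) q = 1 := by
    intro q
    by_cases hq : ι q = 1
    · exact hone' q hq
    · exact hone q (hzero q) hq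
  have hrec : ∀ m n, (1 - ι m) * y m n + (ι m + 1) * y (m - o) n = 2 := by
    intro m n
    have h := hder' m n (-o) (m + n) (m - o) rfl (by abel)
    rw [hneg, hzero, hsymm (m + n), hsymm n (-o), hsymm n (m - o), hm1, hm1, hf, map_neg, ho] at h
    linear_combination -2 * h
  have h1 := hrec (m + o) n
  have h2 := hrec (n + o) m
  have h3 := hder o m n
  rw [add_sub_cancel_right] at h1 h2
  rw [hf, hf] at h3
  rw [hsymm (n + o) m, hsymm n m] at h2
  rw [add_comm o m, add_comm o n] at h3
  simp only [map_add, ho] at h1 h2 h3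
  linear_combination (h1 + h2 + h3) / 4

/-! ### Structure constants of the odd part when the odd bracket is central -/

/-- The constants of `[L_m, G_n] = f(m, n) G_{m+n}` and `[G_n, G_{-o-n}] = g(n) c`, in the units in
which `G_0` has weight `1/2` and `o` is the index `1`. The vectors `G_n` are normalized by `hf0` and
`hg0`; the first does not restrict `G_{-o}`, since `L_{-o}` annihilates `G_0`. The hypotheses
`hanti` and `hlie` say that the bracket of `V` is equivariant and that `V` is a module.

The action of `L_{-o}` shows that `g` is invariant under `n ↦ n - o` away from `ι n = 0, ±1`. On the
coset of a non-integral `ι n`, the ratio `ρ = g(n) / g(o)` satisfies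
`(ρ - 1) (ι n (ρ + 2) + 4 ρ) = 0`, and so it does for `n + o`, which forces `ρ = 1`. With `g` constant
the `f(m, n)` are determined. -/
theorem halfDensity_structureConstants {ι : A →+ F} (hι : Function.Injective ι) {o : A}
    (ho : ι o = 1) {f : A → A → F} {g : A → F} (hg : ∀ n, g n ≠ 0) (hgsymm : ∀ n, g (-o - n) = g n)
    (hg0 : g 0 = g o) (hanti : ∀ m n, f m n * g (m + n) = -f m (-o - m - n) * g n)
    (hf0 : ∀ m, f m 0 = (1 + ι m) / 2)
    (hlie : ∀ m k n, f k n * f m (n + k) - f m n * f k (n + m) = (ι k - ι m) * f (m + k) n) :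
    (∀ n, g n = g 0) ∧ ∀ m n, f m n = 1 / 2 + ι n + ι m / 2 := by
  have hlie' : ∀ m k n p q r, n + k = p → n + m = q → m + k = r →
      f k n * f m p - f m n * f k q = (ι k - ι m) * f r n := by
    rintro m k n _ _ _ rfl rfl rfl
    exact hlie m k n
  have hbase : ∀ m k, (1 + ι k) * f m k - (1 + ι m) * f k m = (ι k - ι m) * (1 + ι m + ι k) := by
    intro m k
    have h := hlie' m k 0 k m (m + k) (by abel) (by abel) rfl
    rw [hf0, hf0, hf0, map_add] at h
    linear_combination 2 * h
  -- Antisymmetry and the Lie relation at the base point, for the six ordered pairs from a triple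
  -- of indices with sum `-1`, express `f` through `g`.
  have hexp : ∀ m n, 2 * (ι n + 1) * (ι m + ι n) * g (m + n) * f m n =
      (ι m + ι n) * (ι m + ι n + 1) * (ι n - ι m) * g (m + n) +
        ι m * (ι m + 1) * (ι m + 2 * ι n + 1) * g m +
        ι n * (ι n + 1) * (2 * ι m + ι n + 1) * g n := by
    intro m n
    obtain ⟨p, hp⟩ : ∃ p, p = -o - m - n := ⟨_, rfl⟩
    have hιp : ι p = -1 - ι m - ι n := by rw [hp]; simp [ho]
    have h1 := hbase m n
    have h2 := hbase m p
    have h3 := hbase n p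
    have a1 := hanti m n
    have a2 := hanti n m
    have a3 := hanti p m
    have hgn : g (p + m) = g n := by rw [← hgsymm n, hp]; congr 1; abel
    rw [← hp] at a1
    rw [show -o - n - m = p by rw [hp]; abel, add_comm n m] at a2
    rw [hgn, show -o - p - m = n by rw [hp]; abel] at a3
    rw [hιp] at h2 h3
    linear_combination (ι m + ι n) * g (m + n) * h1 + (1 + ι n) * g n * h2 +
      (1 + ι m) * g m * h3 + (1 + ι n) * (ι m + ι n) * a1 + (1 + ι m) * (ι m + ι n) * a2 +
      (1 + ι m) * (1 + ι n) * a3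
  have hneg : ∀ n, ι n + 1 ≠ 0 → f (-o) n = ι n := by
    intro n hn
    have h := hbase (-o) n
    rw [map_neg, ho] at h
    apply mul_left_cancel₀ hn
    linear_combination h
  have hshift : ∀ n, ι n ≠ 0 → ι n + 1 ≠ 0 → ι n - 1 ≠ 0 → g (n - o) = g n := by
    intro n h0 h1 h2
    have h := hanti (-o) n
    rw [show -o - -o - n = -n by abel, show -o + n = n - o by abel, hneg n h1, hneg, map_neg] at h
    · apply mul_left_cancel₀ h0
      linear_combination h
    · rw [map_neg]
      intro h3
      apply h2
      linear_combination -h3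
  have hpos : ∀ j : ℕ, g ((j + 1 : ℤ) • o) = g o := by
    intro j
    induction j with
    | zero => simp
    | succ i ih =>
      have e : ι (((i + 1 : ℕ) + 1 : ℤ) • o) = (i : F) + 2 := by
        rw [map_zsmul, ho, zsmul_one]
        push_cast
        ring
      have hne : ∀ k : ℕ, (i : F) + (k + 1) ≠ 0 := fun k => by exact_mod_cast (i + k).succ_ne_zero
      have h0 := hne 1
      have h1 := hne 2
      have h2 := hne 0
      push_cast at h0 h1 h2
      rw [← ih, ← hshift]
      · congr 1
        push_cast
        rw [add_smul, one_smul, add_sub_cancel_right]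
      · rw [e]
        intro h
        apply h0
        linear_combination h
      · rw [e]
        intro h
        apply h1
        linear_combination h
      · rw [e]
        intro h
        apply h2
        linear_combination h
  have hint : ∀ j : ℤ, g (j • o) = g o := by
    intro j
    rcases lt_trichotomy j 0 with h | rfl | h
    · rcases eq_or_ne j (-1) with rfl | h1
      · rw [← hg0, ← hgsymm 0]
        simp
      · obtain ⟨i, hi⟩ := Int.eq_ofNat_of_zero_le (show 0 ≤ -2 - j by omega)
        rw [← hpos i, ← hgsymm]
        congr 1
        rw [show (i : ℤ) + 1 = -1 - j by omega, sub_smul, neg_smul, one_smul]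
    · rw [zero_smul, hg0]
    · obtain ⟨i, hi⟩ := Int.eq_ofNat_of_zero_le (show 0 ≤ j - 1 by omega)
      rw [← hpos i, ← hi, sub_add_cancel]
  have hfoo : f o o = 2 := by
    have h := hexp o o
    have h2 := hint 2
    rw [two_smul] at h2
    rw [h2, ho] at h
    apply mul_left_cancel₀ (hg o)
    linear_combination h / 8
  have hone : ∀ n, (∀ j : ℤ, ι n ≠ j) → (g n - g o) * (ι n * (g n + 2 * g o) + 4 * g n) = 0 := by
    intro n hn
    have hne : ∀ j : ℤ, ι n - j ≠ 0 := fun j => sub_ne_zero.2 (hn j)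
    have h0 := hne 0
    have h1 := hne 1
    have h2 := hne (-1)
    have h3 := hne 2
    have h4 := hne (-2)
    have h5 := hne 3
    push_cast at h0 h1 h2 h3 h4 h5
    have s1 : g (n + o) = g n := by
      rw [← hshift (n + o), add_sub_cancel_right] <;> rw [map_add, ho] <;> intro h
      exacts [h2 (by linear_combination h), h4 (by linear_combination h),
        h0 (by linear_combination h)]
    have s2 : g (n - o) = g n := by
      apply hshift <;> intro h
      exacts [h0 (by linear_combination h), h2 (by linear_combination h),
        h1 (by linear_combination h)]
    have s3 : g (n - o - o) = g n := by
      rw [← s2]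
      apply hshift <;> rw [map_sub, ho] <;> intro h
      exacts [h1 (by linear_combination h), h0 (by linear_combination h),
        h3 (by linear_combination h)]
    have s4 : g (n - o - o - o) = g n := by
      rw [← s3]
      apply hshift <;> rw [map_sub, map_sub, ho] <;> intro h
      exacts [h3 (by linear_combination h), h1 (by linear_combination h),
        h5 (by linear_combination h)]
    have s5 : g (o - n) = g n := by rw [← s3, ← hgsymm]; congr 1; abel
    have s6 : g (o + o - n) = g n := by rw [← s4, ← hgsymm]; congr 1; abel
    have e := hlie' o (o - n) n o (n + o) (o + o - n) (by abel) rfl (by abel)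
    have b1 := hexp (o - n) n
    have b2 := hexp o n
    have b3 := hexp (o - n) (n + o)
    have b4 := hexp (o + o - n) n
    have g2 : g (o + o) = g o := by rw [← two_zsmul, hint]
    rw [show o - n + n = o by abel, s5] at b1
    rw [add_comm o n, s1] at b2
    rw [show o - n + (n + o) = o + o by abel, s5, s1, g2] at b3
    rw [show o + o - n + n = o + o by abel, s6, g2] at b4
    rw [hfoo] at e
    simp only [map_add, map_sub, ho] at e b1 b2 b3 b4
    have h2' : ι n + 1 ≠ 0 := fun h => h2 (by linear_combination h)
    have b2' : 2 * (ι n + 1) * g n * f o n =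
        (ι n + 2) * (ι n - 1) * g n + 4 * g o + ι n * (ι n + 3) * g n := by
      apply mul_left_cancel₀ h2'
      linear_combination b2
    linear_combination ((ι n + 1) * (ι n + 2) * g o * g n / 3) * e -
      (ι n + 2) * g n * b1 / 3 + ((ι n + 2) * g o * f (o - n) (n + o) / 6) * b2' +
      ((ι n + 2) * (ι n - 1) * g n + 4 * g o + ι n * (ι n + 3) * g n) / 24 * b3 -
      ι n * (ι n + 2) * g n * b4 / 12
  have hconst : ∀ n, g n = g o := by
    intro n
    by_cases hn : ∃ j : ℤ, ι n = j
    · obtain ⟨j, hj⟩ := hn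
      rw [← hint j]
      congr 1
      apply hι
      rw [hj, map_zsmul, ho, zsmul_one]
    · push Not at hn
      have h1 := hone n hn
      have hn1 : ∀ j : ℤ, ι (n + o) ≠ j := by
        intro j hj
        apply hn (j - 1)
        rw [map_add, ho] at hj
        push_cast
        linear_combination hj
      have h2 := hone (n + o) hn1
      have h3 : g (n + o) = g n := by
        rw [← hshift (n + o), add_sub_cancel_right]
        · exact_mod_cast hn1 0
        · intro h
          apply hn1 (-1)
          push_cast
          linear_combination h
        · intro h
          apply hn1 1
          push_cast
          linear_combination h
      rw [h3, map_add, ho] at h2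
      by_contra h
      have h4 := (mul_eq_zero.1 h1).resolve_left (sub_ne_zero.2 h)
      have h5 := (mul_eq_zero.1 h2).resolve_left (sub_ne_zero.2 h)
      apply hg n
      linear_combination (h4 + ι n * (h4 - h5)) / 4
  have hgen : ∀ m n, ι n + 1 ≠ 0 → ι m + ι n ≠ 0 → f m n = 1 / 2 + ι n + ι m / 2 := by
    intro m n h1 h2
    have h := hexp m n
    rw [hconst, hconst m, hconst n] at h
    apply mul_left_cancel₀ (mul_ne_zero (mul_ne_zero h1 h2) (hg o))
    linear_combination h / 2
  refine ⟨fun n => by rw [hconst, hconst 0], ?_⟩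
  -- The remaining cases concern the weights `-1/2` and `1/2`; they are reached in two steps.
  have hbot : ∀ m, f m (-o) = -1 / 2 + ι m / 2 := by
    intro m
    by_cases hm : ι m = 1
    · obtain rfl : m = o := hι (hm.trans ho.symm)
      have h := hanti m (-m)
      rw [show -m - m - -m = -m by abel, hconst, hconst (-m)] at h
      apply mul_left_cancel₀ (hg m)
      rw [hm]
      linear_combination h / 2
    · have hm' : ι m - 1 ≠ 0 := sub_ne_zero.2 hm
      have key : ∀ n, ι n ≠ 0 → ι n + 1 ≠ 0 → ι m + ι n ≠ 0 → ι n + ι m + 1 ≠ 0 →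
          f m (-o) = -1 / 2 + ι m / 2 := by
        intro n h0 h1 h2 h3
        have e := hlie' m (-o - n) n (-o) (n + m) (m - o - n) (by abel) (by abel) (by abel)
        have h4 : ι (-o - n) + ι n ≠ 0 := by
          rw [map_sub, map_neg, ho, sub_add_cancel]
          norm_num
        rw [hgen (-o - n) n h1 h4, hgen m n h1 h2, hgen (-o - n) (n + m), hgen (m - o - n) n h1] at e
        · simp only [map_add, map_sub, map_neg, ho] at e
          apply mul_left_cancel₀ h0
          linear_combination 2 * e
        · simp only [map_sub, ho]
          intro h
          apply hm'
          linear_combination h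
        · rwa [map_add]
        · simp only [map_add, map_sub, map_neg, ho]
          intro h
          apply hm'
          linear_combination h
      by_cases h1 : ι m = -1 ∨ ι m = -2
      · apply key (3 • o)
        all_goals
          rw [map_nsmul, ho, nsmul_one]
          rcases h1 with h | h <;> (try rw [h]) <;> norm_num
      · push Not at h1
        apply key o
        all_goals rw [ho]
        · exact one_ne_zero
        · norm_num
        · exact fun h => h1.1 (by linear_combination h)
        · exact fun h => h1.2 (by linear_combination h)
  intro m n
  by_cases h1 : ι n + 1 = 0
  · obtain rfl : n = -o := hι (by rw [map_neg, ho]; linear_combination h1)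
    rw [hbot, map_neg, ho]
    ring
  by_cases h2 : ι m + ι n = 0
  · obtain rfl : n = -m := hι (by rw [map_neg]; linear_combination h2)
    have h := hanti m (-m)
    rw [show -o - m - -m = -o by abel, hbot, hconst, hconst (-m)] at h
    apply mul_left_cancel₀ (hg o)
    rw [map_neg]
    linear_combination h
  · exact hgen m n h1 h2

end StructureConstants

/-! ### The generalized Virasoro algebra -/

namespace Vir

variable {F : Type*} [Field F] (M : AddSubgroup F)

/-- The central basis element of `Vir[M]`. -/
noncomputable def c : Vir M := (Finsupp.single .c 1 : VirIndex M →₀ F)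

/-- The basis `{L_μ, c | μ ∈ M}` of `Vir[M]`. -/
noncomputable def basis : Module.Basis (VirIndex M) F (Vir M) :=
  Module.Basis.ofRepr (LinearEquiv.refl F (VirIndex M →₀ F))

@[simp] theorem basis_L (μ : M) : basis M (.L μ) = L M μ := rfl

@[simp] theorem basis_c : basis M .c = c M := rfl

/-- The linear form with value `1` on every `L_μ` and `0` on `c`. On a weight vector it is the
coefficient of the only `L_μ` which occurs. -/
noncomputable def coeffL : Vir M →ₗ[F] F :=
  (basis M).constr F fun i => VirIndex.casesOn i (fun _ => 1) 0

/-- The coefficient of `c`. -/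
noncomputable def coeffC : Vir M →ₗ[F] F := (basis M).coord .c

@[simp] theorem coeffL_L (μ : M) : coeffL M (L M μ) = 1 := by
  rw [← basis_L, coeffL, Module.Basis.constr_basis]

@[simp] theorem coeffL_c : coeffL M (c M) = 0 := by
  rw [← basis_c, coeffL, Module.Basis.constr_basis]

@[simp] theorem coeffC_L (μ : M) : coeffC M (L M μ) = 0 := by
  rw [← basis_L, coeffC, Module.Basis.coord_apply, Module.Basis.repr_self,
    Finsupp.single_eq_of_ne (by simp)]

@[simp] theorem coeffC_c : coeffC M (c M) = 1 := by
  rw [← basis_c, coeffC, Module.Basis.coord_apply, Module.Basis.repr_self, Finsupp.single_eq_same]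

variable {M}

theorem induction {p : Vir M → Prop} (hL : ∀ μ, p (L M μ)) (hc : p (c M)) (h0 : p 0)
    (hadd : ∀ X Y, p X → p Y → p (X + Y)) (hsmul : ∀ (t : F) X, p X → p (t • X)) (X : Vir M) :
    p X := by
  have hX : X ∈ Submodule.span F (Set.range (basis M)) := by rw [(basis M).span_eq]; trivial
  induction hX using Submodule.span_induction with
  | zero => exact h0
  | add Y Z _ _ hY hZ => exact hadd Y Z hY hZ
  | smul t Y _ hY => exact hsmul t Y hY
  | mem Y hY =>
    obtain ⟨i, rfl⟩ := hY
    cases i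
    exacts [hL _, hc]

theorem ext_coeff {X Y : Vir M} (h : ∀ μ, (basis M).repr X (.L μ) = (basis M).repr Y (.L μ))
    (hc : coeffC M X = coeffC M Y) : X = Y := by
  apply (basis M).repr.injective
  ext i
  cases i
  exacts [h _, hc]

variable [CharZero F]

open Classical in
theorem lie_L_L (μ ν : M) : ⁅L M μ, L M ν⁆ = ((ν : F) - μ) • L M (μ + ν) +
    (if μ + ν = 0 then ((μ : F) ^ 3 - μ) / 12 else 0) • c M := by
  have h : ⁅L M μ, L M ν⁆ = (br M (.L μ) (.L ν) : VirIndex M →₀ F) := by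
    change LieSuperalgebra.basisBracket (br M) (Finsupp.single _ 1) (Finsupp.single _ 1) = _
    rw [LieSuperalgebra.basisBracket_single, one_mul, one_smul]
  have h2 : (μ : F) + ν = 0 ↔ μ + ν = 0 := by
    rw [← ZeroMemClass.coe_eq_zero, AddSubgroup.coe_add]
  rw [h]
  simp only [br, h2]
  exact congrArg₂ (fun a b : VirIndex M →₀ F => a + b) (Finsupp.smul_single_one _ _).symm
    (Finsupp.smul_single_one _ _).symm

theorem c_lie (X : Vir M) : ⁅c M, X⁆ = 0 := by
  induction X using Vir.induction with
  | h0 => exact lie_zero _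
  | hadd X Y hX hY => rw [lie_add, hX, hY, add_zero]
  | hsmul t X hX => rw [lie_smul, hX, smul_zero]
  | hL μ =>
    change LieSuperalgebra.basisBracket (br M) (Finsupp.single _ 1) (Finsupp.single _ 1) = 0
    rw [LieSuperalgebra.basisBracket_single, one_mul, one_smul]
    rfl
  | hc =>
    change LieSuperalgebra.basisBracket (br M) (Finsupp.single _ 1) (Finsupp.single _ 1) = 0
    rw [LieSuperalgebra.basisBracket_single, one_mul, one_smul]
    rfl

theorem lie_c (X : Vir M) : ⁅X, c M⁆ = 0 := by
  rw [← lie_skew, c_lie, neg_zero]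

theorem repr_L_zero_lie_L (X : Vir M) (μ : M) :
    (basis M).repr ⁅L M 0, X⁆ (.L μ) = μ * (basis M).repr X (.L μ) := by
  classical
  induction X using Vir.induction with
  | h0 => simp
  | hadd X Y hX hY => rw [lie_add, map_add, map_add, Finsupp.add_apply, Finsupp.add_apply, hX, hY,
      mul_add]
  | hsmul t X hX => rw [lie_smul, map_smul, map_smul, Finsupp.smul_apply, Finsupp.smul_apply, hX,
      smul_eq_mul, smul_eq_mul, mul_left_comm]
  | hL ν =>
    rw [lie_L_L, ← basis_L, ← basis_L, ← basis_c]
    simp only [zero_add, map_add, map_smul, Module.Basis.repr_self]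
    by_cases h : ν = μ
    · subst h
      simp
    · have h' : (VirIndex.L ν : VirIndex M) ≠ .L μ := fun e => h (by injection e)
      simp [h']
  | hc => rw [lie_c, ← basis_c, Module.Basis.repr_self]; simp

theorem coeffC_L_zero_lie (X : Vir M) : coeffC M ⁅L M 0, X⁆ = 0 := by
  induction X using Vir.induction with
  | h0 => simp
  | hadd X Y hX hY => rw [lie_add, map_add, hX, hY, add_zero]
  | hsmul t X hX => rw [lie_smul, map_smul, hX, smul_zero]
  | hL ν =>
    classical
    rw [lie_L_L]
    simp
  | hc => simp [lie_c]

/-- The weight vectors of the adjoint module, of weight `l ∈ M`. -/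
theorem eq_of_lie_eq_smul {X : Vir M} {l : M} (h : ⁅L M 0, X⁆ = (l : F) • X) :
    X = coeffL M X • L M l + coeffC M X • c M := by
  have h1 : X = (basis M).repr X (.L l) • L M l + coeffC M X • c M := by
    apply ext_coeff
    · intro μ
      rw [map_add, map_smul, map_smul, ← basis_L, ← basis_c, Module.Basis.repr_self,
        Module.Basis.repr_self]
      have h2 := repr_L_zero_lie_L X μ
      rw [h, map_smul, Finsupp.smul_apply, smul_eq_mul] at h2
      by_cases hμ : l = μ
      · subst hμ
        simp
      · have h' : (VirIndex.L l : VirIndex M) ≠ .L μ := fun e => hμ (by injection e)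
        have h3 : (l : F) - μ ≠ 0 := sub_ne_zero.2 fun e => hμ (Subtype.ext e)
        have h4 : (basis M).repr X (.L μ) = 0 := by
          apply mul_left_cancel₀ h3
          linear_combination h2
        simp [h4, h']
    · simp
  have h5 : coeffL M X = (basis M).repr X (.L l) := by
    conv_lhs => rw [h1]
    simp
  rw [h5]
  exact h1

theorem coeffC_eq_zero_of_lie_eq_smul {X : Vir M} {l : F} (h : ⁅L M 0, X⁆ = l • X) (hl : l ≠ 0) :
    coeffC M X = 0 := by
  have h1 := coeffC_L_zero_lie X
  rw [h, map_smul, smul_eq_mul] at h1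
  exact (mul_eq_zero.1 h1).resolve_left hl

theorem eq_zero_of_lie_eq_smul {X : Vir M} {l : F} (h : ⁅L M 0, X⁆ = l • X) (hl : l ∉ M) :
    X = 0 := by
  apply ext_coeff
  · intro μ
    have h2 := repr_L_zero_lie_L X μ
    rw [h, map_smul, Finsupp.smul_apply, smul_eq_mul] at h2
    have h3 : l - μ ≠ 0 := sub_ne_zero.2 fun e => hl (e ▸ μ.2)
    rw [map_zero, Finsupp.zero_apply]
    apply mul_left_cancel₀ h3
    linear_combination h2
  · rw [map_zero]
    exact coeffC_eq_zero_of_lie_eq_smul h fun e => hl (e ▸ M.zero_mem)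

end Vir

/-! ### Weight vectors -/

namespace Vir

variable {F : Type*} [Field F] [CharZero F] (M : AddSubgroup F) {V : Type*} [AddCommGroup V]
  [Module F V] [LieRingModule (Vir M) V]

/-- `x` satisfies `L₀ x = l x`; the vector `0` is allowed. -/
def HasWeight (l : F) (x : V) : Prop := ⁅L M 0, x⁆ = l • x

variable (V) in
/-- Two vectors of the same weight are proportional. -/
def WeightsSimple : Prop :=
  ∀ (l : F) (x y : V), HasWeight M l x → HasWeight M l y → x ≠ 0 → ∃ t : F, y = t • x

variable {M}

theorem HasWeight.congr {l l' : F} {x : V} (h : HasWeight M l x) (e : l = l') :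
    HasWeight M l' x := e ▸ h

variable [LieModule F (Vir M) V]

theorem hasWeight_iff {l : F} {x : V} :
    HasWeight M l x ↔ x ∈ (LieModule.toEnd F (Vir M) V (L M 0)).eigenspace l := by
  rw [Module.End.mem_eigenspace_iff, LieModule.toEnd_apply_apply, HasWeight]

theorem HasWeight.smul {l : F} {x : V} (h : HasWeight M l x) (t : F) : HasWeight M l (t • x) := by
  rw [HasWeight] at *
  rw [lie_smul, h, smul_comm]

theorem HasWeight.lie {l : F} {x : V} (h : HasWeight M l x) (μ : M) :
    HasWeight M (l + μ) ⁅L M μ, x⁆ := by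
  have h1 : ⁅L M 0, L M μ⁆ = (μ : F) • L M μ := by
    rw [lie_L_L]
    simp
  rw [HasWeight] at *
  rw [leibniz_lie, h1, smul_lie, h, lie_smul, add_smul, add_comm]

theorem lie_lie_comm (hc : ∀ x : V, ⁅c M, x⁆ = 0) {μ ν ρ : M} (h : μ + ν = ρ) (x : V) :
    ⁅L M μ, ⁅L M ν, x⁆⁆ = ⁅L M ν, ⁅L M μ, x⁆⁆ + ((ν : F) - μ) • ⁅L M ρ, x⁆ := by
  rw [leibniz_lie, lie_L_L, add_lie, smul_lie, smul_lie, hc, smul_zero, add_zero, h, add_comm]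

/-- A nonzero vector `v` of weight `ν ≠ 0` is not annihilated by all of `L_δ`, `L_{2δ}`, `L_{3δ}`.
Otherwise `L_{-δ}² v` and `L_{-2δ} v` are proportional, which forces `ν = -5δ/8`, and so are
`L_{-2δ} L_{-δ} v` and `L_{-3δ} v`, which excludes this value. -/
theorem eq_zero_of_highestWeight (hc : ∀ x : V, ⁅c M, x⁆ = 0) (hV : WeightsSimple M V) {ν : F}
    {v : V} (hv : HasWeight M ν v) (hν : ν ≠ 0) {δ : M} (hδ : δ ≠ 0) (h1 : ⁅L M δ, v⁆ = 0)
    (h2 : ⁅L M (2 • δ), v⁆ = 0) (h3 : ⁅L M (3 • δ), v⁆ = 0) : v = 0 := by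
  by_contra hv0
  obtain ⟨d, hd⟩ : ∃ d : F, (δ : F) = d := ⟨_, rfl⟩
  have hd0 : d ≠ 0 := by
    rw [← hd]
    exact fun h => hδ (Subtype.ext h)
  have w1 := hv.lie (-δ)
  have w2 := hv.lie (-(2 • δ))
  have w11 := w1.lie (-δ)
  have w3 := hv.lie (-(3 • δ))
  have w12 := w1.lie (-(2 • δ))
  have key : ∀ (a b r : M), a + b = r → ∀ x : V, ⁅L M a, ⁅L M b, x⁆⁆ =
      ⁅L M b, ⁅L M a, x⁆⁆ + ((b : F) - a) • ⁅L M r, x⁆ := fun a b r h x => lie_lie_comm hc h x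
  have e11 : ⁅L M δ, ⁅L M (-δ), v⁆⁆ = (-2 * d * ν) • v := by
    rw [key δ (-δ) 0 (by abel), h1, lie_zero, zero_add, hv]
    simp only [AddSubgroup.coe_neg, hd, smul_smul]
    congr 1; ring
  have e22 : ⁅L M (2 • δ), ⁅L M (-(2 • δ)), v⁆⁆ = (-4 * d * ν) • v := by
    rw [key (2 • δ) (-(2 • δ)) 0 (by abel), h2, lie_zero, zero_add, hv]
    simp only [AddSubgroup.coe_neg, AddSubgroup.coe_nsmul, hd, smul_smul, nsmul_eq_mul]
    congr 1; push_cast; ring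
  have e33 : ⁅L M (3 • δ), ⁅L M (-(3 • δ)), v⁆⁆ = (-6 * d * ν) • v := by
    rw [key (3 • δ) (-(3 • δ)) 0 (by abel), h3, lie_zero, zero_add, hv]
    simp only [AddSubgroup.coe_neg, AddSubgroup.coe_nsmul, hd, smul_smul, nsmul_eq_mul]
    congr 1; push_cast; ring
  have e21 : ⁅L M (2 • δ), ⁅L M (-δ), v⁆⁆ = 0 := by
    rw [key (2 • δ) (-δ) δ (by abel), h1, h2, lie_zero, smul_zero, add_zero]
  have e31 : ⁅L M (3 • δ), ⁅L M (-δ), v⁆⁆ = 0 := by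
    rw [key (3 • δ) (-δ) (2 • δ) (by abel), h2, h3, lie_zero, smul_zero, add_zero]
  have e12 : ⁅L M δ, ⁅L M (-(2 • δ)), v⁆⁆ = (-3 * d) • ⁅L M (-δ), v⁆ := by
    rw [key δ (-(2 • δ)) (-δ) (by abel), h1, lie_zero, zero_add]
    simp only [AddSubgroup.coe_neg, AddSubgroup.coe_nsmul, hd, nsmul_eq_mul]
    congr 1; push_cast; ring
  have e13 : ⁅L M δ, ⁅L M (-(3 • δ)), v⁆⁆ = (-4 * d) • ⁅L M (-(2 • δ)), v⁆ := by
    rw [key δ (-(3 • δ)) (-(2 • δ)) (by abel), h1, lie_zero, zero_add]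
    simp only [AddSubgroup.coe_neg, AddSubgroup.coe_nsmul, hd, nsmul_eq_mul]
    congr 1; push_cast; ring
  have e211 : ⁅L M (2 • δ), ⁅L M (-δ), ⁅L M (-δ), v⁆⁆⁆ = (6 * d ^ 2 * ν) • v := by
    rw [key (2 • δ) (-δ) δ (by abel), e21, lie_zero, zero_add, e11]
    simp only [AddSubgroup.coe_neg, AddSubgroup.coe_nsmul, hd, smul_smul, nsmul_eq_mul]
    congr 1; push_cast; ring
  have e111 : ⁅L M δ, ⁅L M (-δ), ⁅L M (-δ), v⁆⁆⁆ = (-2 * d * (2 * ν - d)) • ⁅L M (-δ), v⁆ := by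
    rw [key δ (-δ) 0 (by abel), e11, lie_smul, w1]
    simp only [AddSubgroup.coe_neg, hd, smul_smul, ← add_smul]
    congr 1; ring
  have e312 : ⁅L M (3 • δ), ⁅L M (-(2 • δ)), ⁅L M (-δ), v⁆⁆⁆ = (10 * d ^ 2 * ν) • v := by
    rw [key (3 • δ) (-(2 • δ)) δ (by abel), e31, lie_zero, zero_add, e11]
    simp only [AddSubgroup.coe_neg, AddSubgroup.coe_nsmul, hd, smul_smul, nsmul_eq_mul]
    congr 1; push_cast; ring
  have e112 : ⁅L M δ, ⁅L M (-(2 • δ)), ⁅L M (-δ), v⁆⁆⁆ =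
      (-2 * d * ν) • ⁅L M (-(2 • δ)), v⁆ + (-3 * d) • ⁅L M (-δ), ⁅L M (-δ), v⁆⁆ := by
    rw [key δ (-(2 • δ)) (-δ) (by abel), e11, lie_smul]
    simp only [AddSubgroup.coe_neg, AddSubgroup.coe_nsmul, hd, nsmul_eq_mul]
    congr 2; push_cast; ring
  have n1 : ⁅L M (-δ), v⁆ ≠ 0 := by
    intro h
    rw [h, lie_zero] at e11
    exact smul_ne_zero (by simp [hd0, hν]) hv0 e11.symm
  have n2 : ⁅L M (-(2 • δ)), v⁆ ≠ 0 := by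
    intro h
    rw [h, lie_zero] at e22
    exact smul_ne_zero (by simp [hd0, hν]) hv0 e22.symm
  have n3 : ⁅L M (-(3 • δ)), v⁆ ≠ 0 := by
    intro h
    rw [h, lie_zero] at e33
    exact smul_ne_zero (by simp [hd0, hν]) hv0 e33.symm
  obtain ⟨t, ht⟩ := hV _ _ _ w2 (w11.congr (by push_cast; ring)) n2
  obtain ⟨s, hs⟩ := hV _ _ _ w3 (w12.congr (by push_cast; ring)) n3
  rw [ht, lie_smul, e22, smul_smul] at e211
  have f1 := smul_left_injective F hv0 e211
  rw [ht, lie_smul, e12, smul_smul] at e111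
  have f2 := smul_left_injective F n1 e111
  rw [hs, lie_smul, e33, smul_smul] at e312
  have f3 := smul_left_injective F hv0 e312
  rw [hs, lie_smul, e13, smul_smul, ht, smul_smul, ← add_smul] at e112
  have f4 := smul_left_injective F n2 e112
  have t1 : t = -3 * d / 2 := by
    apply mul_left_cancel₀ (mul_ne_zero hd0 hν)
    linear_combination (-1 / 4 : F) * f1
  have s1 : s = -5 * d / 3 := by
    apply mul_left_cancel₀ (mul_ne_zero hd0 hν)
    linear_combination (-1 / 6 : F) * f3
  have g2 : ν = -5 * d / 8 := by
    apply mul_left_cancel₀ hd0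
    rw [t1] at f2
    linear_combination (1 / 4 : F) * f2
  rw [s1, t1, g2] at f4
  have : d ^ 2 = 0 := by linear_combination (12 / 11 : F) * f4
  exact hd0 (pow_eq_zero_iff two_ne_zero |>.1 this)

end Vir

/-! ### Irreducible modules with simple weights and their pairings into `Vir[M]` -/

namespace Vir

variable {F : Type*} [Field F] [CharZero F] {M : AddSubgroup F} {V : Type*} [AddCommGroup V]
  [Module F V] [LieRingModule (Vir M) V]

theorem eq_top_of_lie_mem [LieModule.IsIrreducible F (Vir M) V] {N : Submodule F V}
    (hN : ∀ (X : Vir M), ∀ x ∈ N, ⁅X, x⁆ ∈ N) (h0 : N ≠ ⊥) : N = ⊤ := by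
  obtain ⟨N', hN'⟩ : ∃ N' : LieSubmodule F (Vir M) V, N'.toSubmodule = N :=
    ⟨{ N with lie_mem := fun {X x} hx => hN X x hx }, rfl⟩
  rcases eq_bot_or_eq_top N' with h | h
  · exact absurd (by rw [← hN', h]; rfl) h0
  · rw [← hN', h]; rfl

variable (M V) in
/-- A bracket on the odd part `V` of a Lie superalgebra with even part `Vir[M]`: a symmetric
equivariant bilinear map `V × V → Vir[M]` which satisfies the Jacobi identity on `V`. -/
structure OddBracket where
  toLin : V →ₗ[F] V →ₗ[F] Vir M
  symm : ∀ u w : V, toLin u w = toLin w u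
  lie : ∀ (X : Vir M) (u w : V), ⁅X, toLin u w⁆ = toLin ⁅X, u⁆ w + toLin u ⁅X, w⁆
  jacobi : ∀ u w z : V, ⁅toLin u w, z⁆ + ⁅toLin w z, u⁆ + ⁅toLin z u, w⁆ = 0

namespace OddBracket

variable (β : OddBracket M V)

theorem hasWeight {l k : F} {u w : V} (hu : HasWeight M l u) (hw : HasWeight M k w) :
    HasWeight M (l + k) (β.toLin u w) := by
  rw [HasWeight] at *
  rw [β.lie, hu, hw, map_smul, map_smul, LinearMap.smul_apply, add_smul]

/-- The sum of the coefficients of the `L_μ` in the bracket. For weight vectors at most one of them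
occurs. -/
noncomputable def formL (u w : V) : F := coeffL M (β.toLin u w)

/-- The coefficient of `c` in the bracket. -/
noncomputable def formC (u w : V) : F := coeffC M (β.toLin u w)

theorem formL_symm (u w : V) : β.formL u w = β.formL w u := by rw [formL, β.symm, formL]

theorem formC_symm (u w : V) : β.formC u w = β.formC w u := by rw [formC, β.symm, formC]

@[simp] theorem formL_smul_left (t : F) (u w : V) : β.formL (t • u) w = t * β.formL u w := by
  simp [formL]

@[simp] theorem formL_smul_right (t : F) (u w : V) : β.formL u (t • w) = t * β.formL u w := by
  simp [formL]

@[simp] theorem formC_smul_left (t : F) (u w : V) : β.formC (t • u) w = t * β.formC u w := by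
  simp [formC]

@[simp] theorem formC_smul_right (t : F) (u w : V) : β.formC u (t • w) = t * β.formC u w := by
  simp [formC]

@[simp] theorem formL_zero_left (w : V) : β.formL 0 w = 0 := by simp [formL]

@[simp] theorem formL_zero_right (w : V) : β.formL w 0 = 0 := by simp [formL]

@[simp] theorem formC_zero_left (w : V) : β.formC 0 w = 0 := by simp [formC]

@[simp] theorem formC_zero_right (w : V) : β.formC w 0 = 0 := by simp [formC]

theorem toLin_eq {l k : F} {u w : V} (hu : HasWeight M l u) (hw : HasWeight M k w) {m : M}
    (hm : l + k = m) : β.toLin u w = β.formL u w • L M m + β.formC u w • c M :=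
  eq_of_lie_eq_smul ((β.hasWeight hu hw).congr hm)

theorem toLin_eq_zero {l k : F} {u w : V} (hu : HasWeight M l u) (hw : HasWeight M k w)
    (hm : l + k ∉ M) : β.toLin u w = 0 :=
  eq_zero_of_lie_eq_smul (β.hasWeight hu hw) hm

theorem mem_of_formL_ne_zero {l k : F} {u w : V} (hu : HasWeight M l u) (hw : HasWeight M k w)
    (h : β.formL u w ≠ 0) : l + k ∈ M := by
  by_contra hm
  apply h
  rw [formL, β.toLin_eq_zero hu hw hm, map_zero]

theorem formC_eq_zero {l k : F} {u w : V} (hu : HasWeight M l u) (hw : HasWeight M k w)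
    (hm : l + k ≠ 0) : β.formC u w = 0 :=
  coeffC_eq_zero_of_lie_eq_smul (β.hasWeight hu hw) hm

theorem formL_lie {l k : F} {u w : V} (hu : HasWeight M l u) (hw : HasWeight M k w) (μ : M) :
    β.formL ⁅L M μ, u⁆ w + β.formL u ⁅L M μ, w⁆ = (l + k - μ) * β.formL u w := by
  have h := congrArg (coeffL M) (β.lie (L M μ) u w)
  rw [map_add] at h
  rw [formL, formL, ← h]
  by_cases hm : l + k ∈ M
  · rw [β.toLin_eq hu hw (m := ⟨l + k, hm⟩) rfl, lie_add, lie_smul, lie_smul, lie_c, lie_L_L]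
    split_ifs <;> simp [mul_comm]
  · simp [formL, β.toLin_eq_zero hu hw hm]

theorem formC_lie {l k : F} {u w : V} (hu : HasWeight M l u) (hw : HasWeight M k w) {μ : M}
    (hμ : l + k + μ = 0) : β.formC ⁅L M μ, u⁆ w + β.formC u ⁅L M μ, w⁆ =
      ((μ : F) ^ 3 - μ) / 12 * β.formL u w := by
  have h := congrArg (coeffC M) (β.lie (L M μ) u w)
  rw [map_add] at h
  rw [formC, formC, ← h, β.toLin_eq hu hw (m := -μ) (by push_cast; linear_combination hμ),
    lie_add, lie_smul, lie_smul, lie_c, lie_L_L]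
  simp [mul_comm]

end OddBracket

variable [LieModule F (Vir M) V]

variable (M V) in
/-- `V` is the sum of its weight spaces. -/
def WeightsSpan : Prop :=
  ⨆ l : F, (LieModule.toEnd F (Vir M) V (L M 0)).eigenspace l = ⊤

theorem WeightsSpan.linearMap_eq_zero (hspan : WeightsSpan M V) {X : Type*} [AddCommGroup X]
    [Module F X] {φ : V →ₗ[F] X} (h : ∀ l x, HasWeight M l x → φ x = 0) : φ = 0 := by
  rw [← LinearMap.ker_eq_top, eq_top_iff, ← hspan, iSup_le_iff]
  exact fun l x hx => h l x (hasWeight_iff.2 hx)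

theorem WeightsSpan.exists_ne_zero [Nontrivial V] (hspan : WeightsSpan M V) :
    ∃ (l : F) (x : V), HasWeight M l x ∧ x ≠ 0 := by
  by_contra! h
  have h1 := hspan.linearMap_eq_zero (φ := LinearMap.id) h
  obtain ⟨x, hx⟩ := exists_ne (0 : V)
  exact hx (LinearMap.congr_fun h1 x)

theorem lie_mem_of_basis {N : Submodule F V} (hL : ∀ (μ : M), ∀ x ∈ N, ⁅L M μ, x⁆ ∈ N)
    (hc : ∀ x ∈ N, ⁅c M, x⁆ ∈ N) (X : Vir M) {x : V} (hx : x ∈ N) : ⁅X, x⁆ ∈ N := by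
  induction X using Vir.induction with
  | hL μ => exact hL μ x hx
  | hc => exact hc x hx
  | h0 => rw [zero_lie]; exact N.zero_mem
  | hadd X Y hX hY => rw [add_lie]; exact N.add_mem hX hY
  | hsmul t X hX => rw [smul_lie]; exact N.smul_mem t hX

/-- All weights of an irreducible module lie in one coset of `M`. -/
theorem sub_mem_of_hasWeight [LieModule.IsIrreducible F (Vir M) V] (hc : ∀ x : V, ⁅c M, x⁆ = 0)
    {l k : F} {x y : V} (hx : HasWeight M l x) (hx0 : x ≠ 0) (hy : HasWeight M k y) (hy0 : y ≠ 0) :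
    k - l ∈ M := by
  by_contra hkl
  let E := (LieModule.toEnd F (Vir M) V (L M 0)).eigenspace
  have htop : ⨆ m : M, E (l + m) = ⊤ := by
    apply eq_top_of_lie_mem (M := M)
    · intro X z hz
      refine lie_mem_of_basis ?_ (fun z _ => by rw [hc]; exact Submodule.zero_mem _) X hz
      intro μ z hz
      induction hz using Submodule.iSup_induction' with
      | mem m z hz =>
        refine Submodule.mem_iSup_of_mem (m + μ) ?_
        have h := ((hasWeight_iff.2 hz).lie μ).congr (l' := l + ((m + μ : M) : F))
          (by push_cast; ring)
        exact hasWeight_iff.1 h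
      | zero => rw [lie_zero]; exact Submodule.zero_mem _
      | add z w _ _ hz hw => rw [lie_add]; exact Submodule.add_mem _ hz hw
    · intro h
      apply hx0
      rw [← Submodule.mem_bot F, ← h]
      refine Submodule.mem_iSup_of_mem 0 ?_
      exact hasWeight_iff.1 (hx.congr (by simp))
  have hdisj := (LieModule.toEnd F (Vir M) V (L M 0)).eigenspaces_iSupIndep k
  have hle : ⨆ m : M, E (l + m) ≤ ⨆ j, ⨆ (_ : j ≠ k), E j := by
    apply iSup_le
    intro m
    refine le_iSup₂_of_le (l + (m : F)) ?_ le_rfl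
    rintro rfl
    apply hkl
    rw [add_sub_cancel_left]
    exact m.2
  rw [htop, top_le_iff] at hle
  have hk : y ∈ (⊥ : Submodule F V) :=
    hdisj.le_bot ⟨hasWeight_iff.1 hy, by
      change y ∈ ⨆ j, ⨆ (_ : j ≠ k), E j
      rw [hle]
      trivial⟩
  exact hy0 ((Submodule.mem_bot F).1 hk)

namespace OddBracket

variable (β : OddBracket M V)

/-- The central element acts on `V` by a scalar, which vanishes since `c` is central in `Vir[M]`
and the bracket of two elements of `V` does not always vanish. -/
theorem c_lie_eq_zero [LieModule.IsIrreducible F (Vir M) V] (hspan : WeightsSpan M V)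
    (hV : WeightsSimple M V) (hβ : β.toLin ≠ 0) (x : V) : ⁅c M, x⁆ = 0 := by
  have : Nontrivial V := LieSubmodule.nontrivial_iff F (Vir M) V |>.1 inferInstance
  obtain ⟨l, v, hv, hv0⟩ := hspan.exists_ne_zero
  have hcomm : ∀ (X : Vir M) (y : V), ⁅c M, ⁅X, y⁆⁆ = ⁅X, ⁅c M, y⁆⁆ := by
    intro X y
    rw [leibniz_lie, c_lie, zero_lie, zero_add]
  have hcv : HasWeight M l ⁅c M, v⁆ := by
    rw [HasWeight, ← hcomm, hv, lie_smul]
  obtain ⟨t, ht⟩ := hV l v _ hv hcv hv0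
  have htop : (LieModule.toEnd F (Vir M) V (c M)).eigenspace t = ⊤ := by
    apply eq_top_of_lie_mem (M := M)
    · intro X y hy
      rw [Module.End.mem_eigenspace_iff, LieModule.toEnd_apply_apply] at *
      rw [hcomm, hy, lie_smul]
    · intro h
      apply hv0
      rw [← Submodule.mem_bot F, ← h, Module.End.mem_eigenspace_iff, LieModule.toEnd_apply_apply,
        ht]
  have hsmul : ∀ y : V, ⁅c M, y⁆ = t • y := by
    intro y
    have hy : y ∈ (LieModule.toEnd F (Vir M) V (c M)).eigenspace t := by rw [htop]; trivial
    rwa [Module.End.mem_eigenspace_iff, LieModule.toEnd_apply_apply] at hy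
  have ht0 : t = 0 := by
    by_contra h0
    apply hβ
    ext u w : 2
    have h := β.lie (c M) u w
    rw [c_lie, hsmul, hsmul, map_smul, map_smul, LinearMap.smul_apply, ← add_smul] at h
    exact (smul_eq_zero.1 h.symm).resolve_left (by rw [← two_mul]; exact mul_ne_zero two_ne_zero h0)
  rw [hsmul, ht0, zero_smul]

end OddBracket

end Vir

/-! ### Central odd brackets -/

namespace Vir

variable {F : Type*} [Field F] [CharZero F] {M : AddSubgroup F} {V : Type*} [AddCommGroup V]
  [Module F V] [LieRingModule (Vir M) V] [LieModule F (Vir M) V]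

theorem WeightsSpan.exists_weight_ne_zero (hspan : WeightsSpan M V) (hc : ∀ x : V, ⁅c M, x⁆ = 0)
    (htriv : ¬ LieModule.IsTrivial (Vir M) V) :
    ∃ (l : F) (x : V), HasWeight M l x ∧ l ≠ 0 ∧ x ≠ 0 := by
  by_contra! h
  apply htriv
  have hL : ∀ (μ : M) (x : V), ⁅L M μ, x⁆ = 0 := by
    intro μ
    have h1 : LieModule.toEnd F (Vir M) V (L M μ) = 0 := by
      apply hspan.linearMap_eq_zero
      intro l x hx
      rw [LieModule.toEnd_apply_apply]
      rcases eq_or_ne μ 0 with rfl | hμ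
      · rw [hx]
        by_cases hl : l = 0
        · rw [hl, zero_smul]
        · rw [h l x hx hl, smul_zero]
      · by_cases hl : l = 0
        · exact h _ _ (hx.lie μ) (by rw [hl, zero_add]; exact fun e => hμ (Subtype.ext e))
        · rw [h l x hx hl, lie_zero]
    exact fun x => LinearMap.congr_fun h1 x
  refine ⟨fun X x => ?_⟩
  induction X using Vir.induction with
  | hL μ => exact hL μ x
  | hc => exact hc x
  | h0 => exact zero_lie x
  | hadd X Y hX hY => rw [add_lie, hX, hY, add_zero]
  | hsmul t X hX => rw [smul_lie, hX, smul_zero]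

namespace OddBracket

variable {β : OddBracket M V}

/-- A central odd bracket is nondegenerate: its kernel is a submodule of `V`. -/
theorem exists_formC_ne_zero [LieModule.IsIrreducible F (Vir M) V] (hspan : WeightsSpan M V)
    (hβ : β.toLin ≠ 0) (hL : ∀ (l k : F) (u w : V), HasWeight M l u → HasWeight M k w →
      β.formL u w = 0) {l : F} {u : V} (hu : HasWeight M l u) (hu0 : u ≠ 0) :
    ∃ w, HasWeight M (-l) w ∧ β.formC u w ≠ 0 := by
  by_contra! h
  have hker : LinearMap.ker β.toLin = ⊤ := by
    apply eq_top_of_lie_mem (M := M)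
    · intro X x hx
      rw [LinearMap.mem_ker] at *
      ext w
      have h1 := β.lie X x w
      rw [hx, LinearMap.zero_apply, LinearMap.zero_apply, lie_zero, add_zero] at h1
      rw [← h1, LinearMap.zero_apply]
    · intro h0
      apply hu0
      rw [← Submodule.mem_bot F, ← h0, LinearMap.mem_ker]
      apply hspan.linearMap_eq_zero
      intro k w hw
      by_cases hm : l + k ∈ M
      · rw [β.toLin_eq hu hw (m := ⟨l + k, hm⟩) rfl, hL l k u w hu hw, zero_smul, zero_add]
        by_cases hlk : l + k = 0
        · rw [h w (hw.congr (by linear_combination hlk)), zero_smul]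
        · rw [β.formC_eq_zero hu hw hlk, zero_smul]
      · exact β.toLin_eq_zero hu hw hm
  exact hβ (LinearMap.ker_eq_top.1 hker)

theorem formC_ne_zero [LieModule.IsIrreducible F (Vir M) V] (hspan : WeightsSpan M V)
    (hV : WeightsSimple M V)
    (hβ : β.toLin ≠ 0) (hL : ∀ (l k : F) (u w : V), HasWeight M l u → HasWeight M k w →
      β.formL u w = 0) {l k : F} {u w : V} (hu : HasWeight M l u) (hu0 : u ≠ 0)
    (hw : HasWeight M k w) (hw0 : w ≠ 0) (hlk : l + k = 0) : β.formC u w ≠ 0 := by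
  obtain ⟨w', hw', h⟩ := exists_formC_ne_zero hspan hβ hL hu hu0
  obtain ⟨t, rfl⟩ := hV _ w w' hw (hw'.congr (by linear_combination -hlk)) hw0
  intro h1
  apply h
  rw [formC_smul_right, h1, mul_zero]

/-- If the odd bracket is central, then a nonzero vector `v` of weight `ν ≠ 0` is annihilated by
`L_{-2ν}` and by no other `L_μ`. Put `o = 2ν`. The indices `m ≠ -o` with `L_m v = 0` are stable under
`m ↦ m - o`, and a vector `v` annihilated by too many `L_m` contradicts
`Vir.eq_zero_of_highestWeight`. -/
theorem lie_ne_zero_of_central [LieModule.IsIrreducible F (Vir M) V] (hspan : WeightsSpan M V)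
    (hV : WeightsSimple M V) (hc : ∀ x : V, ⁅c M, x⁆ = 0)
    (hβ : β.toLin ≠ 0) (hL : ∀ (l k : F) (u w : V), HasWeight M l u → HasWeight M k w →
      β.formL u w = 0) {ν : F} {v : V} (hv : HasWeight M ν v) (hv0 : v ≠ 0) (hν : ν ≠ 0) {o : M}
    (ho : (o : F) = 2 * ν) : ⁅L M (-o), v⁆ = 0 ∧ ∀ μ, μ ≠ -o → ⁅L M μ, v⁆ ≠ 0 := by
  have hskew : ∀ (l k : F) (u w : V), HasWeight M l u → HasWeight M k w → ∀ μ : M,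
      l + k + μ = 0 → β.formC ⁅L M μ, u⁆ w = -β.formC u ⁅L M μ, w⁆ := by
    intro l k u w hu hw μ h
    have h1 := β.formC_lie hu hw h
    rw [hL l k u w hu hw] at h1
    linear_combination h1
  have hnd : ∀ (l k : F) (u w : V), HasWeight M l u → HasWeight M k w → l + k = 0 →
      β.formC u w = 0 → u = 0 ∨ w = 0 := by
    intro l k u w hu hw hlk h
    by_contra! h1
    exact formC_ne_zero hspan hV hβ hL hu h1.1 hw h1.2 hlk h
  have hann : ⁅L M (-o), v⁆ = 0 := by
    have h1 := hskew ν ν v v hv hv (-o) (by push_cast; rw [ho]; ring)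
    rw [β.formC_symm] at h1
    have h2 := hnd _ _ _ _ hv (hv.lie (-o)) (by push_cast; rw [ho]; ring)
      (by linear_combination h1 / 2)
    exact h2.resolve_left hv0
  refine ⟨hann, ?_⟩
  have ho0 : (o : F) ≠ 0 := by rw [ho]; exact mul_ne_zero two_ne_zero hν
  have hcomm : ∀ (a b r : M), a + b = r → ⁅L M a, ⁅L M b, v⁆⁆ =
      ⁅L M b, ⁅L M a, v⁆⁆ + ((b : F) - a) • ⁅L M r, v⁆ := fun a b r h => lie_lie_comm hc h v
  have hlow : ∀ m : M, ⁅L M (-o), ⁅L M m, v⁆⁆ = ((m : F) + o) • ⁅L M (m - o), v⁆ := by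
    intro m
    rw [hcomm (-o) m (m - o) (by abel), hann, lie_zero, zero_add]
    push_cast
    rw [sub_neg_eq_add]
  have hdown : ∀ m : M, m ≠ -o → ⁅L M m, v⁆ = 0 → ⁅L M (m - o), v⁆ = 0 := by
    intro m hm h
    have h1 := hlow m
    rw [h, lie_zero] at h1
    refine (smul_eq_zero.1 h1.symm).resolve_left fun h2 => hm (Subtype.ext ?_)
    push_cast
    linear_combination h2
  have hdown' : ∀ (m : M), ⁅L M m, v⁆ = 0 → ∀ k : ℕ, (∀ j : ℕ, j < k → m - (j : ℤ) • o ≠ -o) →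
      ⁅L M (m - (k : ℤ) • o), v⁆ = 0 := by
    intro m hm k
    induction k with
    | zero => intro _; simpa using hm
    | succ k ih =>
      intro hk
      have h := hdown _ (hk k (Nat.lt_succ_self k)) (ih fun j hj => hk j (hj.trans k.lt_succ_self))
      rw [show m - ((k + 1 : ℕ) : ℤ) • o = m - (k : ℤ) • o - o by push_cast; rw [add_smul]; abel_nf]
      exact h
  have hzsmul : ∀ i j : ℤ, i • o = j • o → i = j := by
    intro i j h
    have h1 := congrArg (Subtype.val) h
    push_cast at h1
    rw [zsmul_eq_mul, zsmul_eq_mul] at h1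
    exact_mod_cast mul_right_cancel₀ ho0 h1
  have hint : ∀ j : ℤ, j ≠ -1 → ⁅L M (j • o), v⁆ ≠ 0 := by
    intro j hj h
    rcases lt_or_ge j 0 with hj0 | hj0
    · have hk : ∀ k : ℕ, ⁅L M ((j - k) • o), v⁆ = 0 := by
        intro k
        rw [sub_smul]
        apply hdown' _ h
        intro i _ h1
        have := hzsmul (j - i) (-1) (by rw [sub_smul, h1]; simp)
        omega
      have h2 := hk (-j).toNat
      have h3 := hk (2 * -j).toNat
      rw [show j - ((-j).toNat : ℤ) = 2 * j by omega] at h2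
      rw [show j - ((2 * -j).toNat : ℤ) = 3 * j by omega] at h3
      refine hv0 (eq_zero_of_highestWeight hc hV hv hν (δ := j • o) ?_ h ?_ ?_)
      · intro h4
        have := hzsmul j 0 (by rw [h4, zero_smul])
        omega
      · rw [mul_smul] at h2
        exact_mod_cast h2
      · rw [mul_smul] at h3
        exact_mod_cast h3
    · have h1 := hdown' _ h j.toNat (by
        intro i hi h1
        have := hzsmul (j - i) (-1) (by rw [sub_smul, h1]; simp)
        omega)
      rw [Int.toNat_of_nonneg hj0, sub_self, hv] at h1
      exact smul_ne_zero hν hv0 h1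
  intro μ hμ h
  by_cases hZ : ∃ j : ℤ, μ = j • o
  · obtain ⟨j, rfl⟩ := hZ
    exact hint j (by rintro rfl; exact hμ (by simp)) h
  push Not at hZ
  -- It remains to treat the cosets of `ℤ o` other than `ℤ o`.
  have hdownZ : ∀ m : M, (∀ j : ℤ, m ≠ j • o) → ⁅L M m, v⁆ = 0 → ∀ k : ℕ,
      ⁅L M (m - (k : ℤ) • o), v⁆ = 0 := by
    intro m hm h k
    apply hdown' m h k
    intro i _ h1
    apply hm (i - 1)
    rw [sub_smul, one_smul, sub_eq_add_neg, ← h1]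
    abel
  by_cases hall : ∀ k : ℤ, ⁅L M (μ + k • o), v⁆ = 0
  · have hkey : ∀ j k : ℤ, j + k = -2 → -2 * (μ : F) + (k - j) * o = 0 := by
      intro j k hjk
      have e1 := hcomm (μ + j • o) (-μ + k • o) ((-2 : ℤ) • o) (by rw [← hjk, add_smul]; abel)
      rw [hall, lie_zero, zero_add] at e1
      have e2 := hcomm (μ + j • o) o (μ + (j + 1) • o) (by rw [add_smul, one_smul]; abel)
      rw [hall, hall, lie_zero, smul_zero, add_zero] at e2
      have hjk' : (j : F) + k = -2 := by exact_mod_cast hjk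
      have e3 := hskew _ _ ⁅L M (-μ + k • o), v⁆ ⁅L M o, v⁆ (hv.lie _) (hv.lie o) (μ + j • o) (by
        push_cast
        rw [zsmul_eq_mul, zsmul_eq_mul, ho]
        linear_combination 2 * ν * hjk')
      rw [e1, e2, formC_zero_right, formC_smul_left, neg_zero] at e3
      have e4 := (mul_eq_zero.1 e3).resolve_right (formC_ne_zero hspan hV hβ hL
        (hv.lie ((-2 : ℤ) • o)) (hint (-2) (by norm_num)) (hv.lie o)
        (by simpa using hint 1 (by norm_num)) (by
          push_cast
          rw [zsmul_eq_mul, ho]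
          push_cast
          ring))
      push_cast at e4
      rw [zsmul_eq_mul, zsmul_eq_mul] at e4
      linear_combination e4
    have h1 := hkey 0 (-2) (by norm_num)
    have h2 := hkey 1 (-3) (by norm_num)
    push_cast at h1 h2
    apply ho0
    linear_combination (h1 - h2) / 2
  · push Not at hall
    obtain ⟨k, hk⟩ := hall
    -- The pairing of `L_m v` with `L_{-o-m} v`, which vanishes on the coset of `μ`.
    obtain ⟨N, hN⟩ : ∃ N : M → F, ∀ m, N m = β.formC ⁅L M m, v⁆ ⁅L M (-o - m), v⁆ :=
      ⟨_, fun _ => rfl⟩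
    have hrec : ∀ m : M, ((m : F) + 2 * o) * N m = m * N (m + o) := by
      intro m
      have h1 := hskew _ _ _ _ (hv.lie (m + o)) (hv.lie (-o - m)) (-o) (by push_cast; rw [ho]; ring)
      rw [hlow, hlow, formC_smul_left, formC_smul_right, add_sub_cancel_right] at h1
      rw [hN, hN, show -o - (m + o) = -o - m - o by abel]
      push_cast at h1
      linear_combination h1
    have hne : ∀ i j : ℤ, ((μ + i • o : M) : F) + j * o ≠ 0 := by
      intro i j h1
      apply hZ (-i - j)
      apply Subtype.ext
      push_cast at h1 ⊢
      rw [zsmul_eq_mul] at h1 ⊢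
      push_cast
      linear_combination h1
    have hN0 : ∀ i : ℤ, N (μ + i • o) = 0 := by
      intro i
      induction i using Int.induction_on with
      | zero => rw [zero_smul, add_zero, hN, h, formC_zero_left]
      | succ i ih =>
        have h1 := hrec (μ + (i : ℤ) • o)
        rw [ih, mul_zero] at h1
        rw [add_smul, one_smul, ← add_assoc]
        refine (mul_eq_zero.1 h1.symm).resolve_left ?_
        simpa using hne i 0
      | pred i ih =>
        have h1 := hrec (μ + (-(i : ℤ) - 1) • o)
        rw [sub_smul, one_smul, add_assoc, sub_add_cancel, ih, mul_zero] at h1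
        rw [sub_smul, one_smul]
        refine (mul_eq_zero.1 h1).resolve_left ?_
        have := hne (-(i : ℤ) - 1) 2
        rw [sub_smul, one_smul] at this
        exact_mod_cast this
    have h1 := hN0 k
    rw [hN] at h1
    have h2 : ⁅L M (-o - (μ + k • o)), v⁆ = 0 :=
      (hnd _ _ _ _ (hv.lie _) (hv.lie _) (by push_cast; rw [ho]; ring) h1).resolve_left hk
    -- Both cosets contain elements which annihilate `v`, and so do all their lower translates and
    -- the commutators of these, among which there are elements of `ℤ o`.
    have h3 : ∀ s : ℕ, -2 ≥ -1 - k - s →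
        ((-o - (μ + k • o) : M) : F) - (μ - (s : ℤ) • o : M) = 0 := by
      intro s hs
      have e := hcomm (μ - (s : ℤ) • o) (-o - (μ + k • o)) ((-1 - k - s) • o) (by
        rw [sub_smul, sub_smul, neg_smul, one_smul]; abel)
      rw [h2, hdownZ μ hZ h s, lie_zero, lie_zero, zero_add] at e
      exact (smul_eq_zero.1 e.symm).resolve_right (hint _ (by omega))
    have h4 := h3 (k.natAbs + 1) (by omega)
    have h5 := h3 (k.natAbs + 1 + 1) (by omega)
    push_cast at h4 h5
    rw [zsmul_eq_mul, zsmul_eq_mul] at h4 h5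
    push_cast at h4 h5
    apply ho0
    linear_combination h5 - h4

end OddBracket

end Vir

namespace Vir

/-- The embedding of `M` into `F`, scaled by `d⁻¹`. -/
def scaledIndex {F : Type*} [Field F] (M : AddSubgroup F) (d : F) : M →+ F :=
  (AddMonoidHom.mulRight d⁻¹).comp M.subtype

theorem scaledIndex_apply {F : Type*} [Field F] {M : AddSubgroup F} (d : F) (m : M) :
    scaledIndex M d m = m / d := by
  simp [scaledIndex, div_eq_mul_inv]

variable {F : Type*} [Field F] [CharZero F] {M : AddSubgroup F} {V : Type*} [AddCommGroup V]
  [Module F V] [LieRingModule (Vir M) V] [LieModule F (Vir M) V]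

namespace OddBracket

variable {β : OddBracket M V}

/-- If `L_μ G_n = f(μ, n) G_{n+μ}` then the `f(μ, n)`, scaled by `d`, satisfy the relations of the
`L_μ`. -/
theorem structureConstants_lie (hc : ∀ x : V, ⁅c M, x⁆ = 0) {G : M → V} (hG0 : ∀ m, G m ≠ 0)
    {f : M → M → F} (hf : ∀ m n, ⁅L M m, G n⁆ = f m n • G (n + m)) {d : F} (hd : d ≠ 0)
    (m k n : M) : f k n / d * (f m (n + k) / d) - f m n / d * (f k (n + m) / d) =
      (scaledIndex M d k - scaledIndex M d m) * (f (m + k) n / d) := by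
  have h := lie_lie_comm hc (rfl : m + k = m + k) (G n)
  rw [hf, hf, hf, lie_smul, lie_smul, hf, hf, smul_smul, smul_smul, smul_smul,
    show n + m + k = n + k + m by abel, show n + (m + k) = n + k + m by abel, ← add_smul] at h
  have h1 := smul_left_injective F (hG0 _) h
  simp only [scaledIndex_apply]
  field_simp
  linear_combination h1

/-- If the odd bracket is central, then there are weight vectors `G_m ≠ 0`, `m ∈ M`, which satisfy the
relations of `S̃Vir`, up to the factor `g`; they form a basis by `Vir.exists_basis_coe_eq`. -/
theorem exists_basis_of_central [LieModule.IsIrreducible F (Vir M) V] (hspan : WeightsSpan M V)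
    (hV : WeightsSimple M V) (hβ : β.toLin ≠ 0) (htriv : ¬ LieModule.IsTrivial (Vir M) V)
    (hL : ∀ (l k : F) (u w : V), HasWeight M l u → HasWeight M k w → β.formL u w = 0) :
    ∃ (ν g : F) (G : M → V), 2 * ν ∈ M ∧ g ≠ 0 ∧ (∀ m : M, HasWeight M (ν + m) (G m)) ∧
      (∀ m, G m ≠ 0) ∧ (∀ μ n : M, ⁅L M μ, G n⁆ = (ν + n + 1 / 2 * μ) • G (n + μ)) ∧
      (∀ m n, β.formL (G m) (G n) = 0) ∧
      ∀ m n : M, ν + m + (ν + n) = 0 → β.formC (G m) (G n) = g := by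
  classical
  have hc := β.c_lie_eq_zero hspan hV hβ
  obtain ⟨ν, v, hv, hν, hv0⟩ := hspan.exists_weight_ne_zero hc htriv
  obtain ⟨w, hw, hvw⟩ := exists_formC_ne_zero hspan hβ hL hv hv0
  have hw0 : w ≠ 0 := by
    rintro rfl
    exact hvw (β.formC_zero_right v)
  have h2ν : 2 * ν ∈ M := by
    have h := sub_mem_of_hasWeight hc hw hw0 hv hv0
    rwa [sub_neg_eq_add, ← two_mul] at h
  obtain ⟨o, ho⟩ : ∃ o : M, (o : F) = 2 * ν := ⟨⟨2 * ν, h2ν⟩, rfl⟩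
  have ho0 : (o : F) ≠ 0 := by rw [ho]; exact mul_ne_zero two_ne_zero hν
  obtain ⟨hann, hne⟩ := lie_ne_zero_of_central hspan hV hc hβ hL hv hv0 hν ho
  have hnd : ∀ (l k : F) (u w : V), HasWeight M l u → HasWeight M k w → u ≠ 0 → w ≠ 0 →
      l + k = 0 → β.formC u w ≠ 0 :=
    fun l k u w hu hw hu0 hw0 h => formC_ne_zero hspan hV hβ hL hu hu0 hw hw0 h
  -- The vectors `G_m` are multiples of the `L_m v`, except for the one of weight `-ν`, which is a
  -- multiple `t w` with `t` chosen such that `[G_0, G_{-o}] = [G_o, G_{-2o}]`.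
  have hcoef : ∀ m : M, m ≠ -o → ν + 1 / 2 * (m : F) ≠ 0 := by
    intro m hm h
    apply hm
    apply Subtype.ext
    push_cast
    rw [ho]
    linear_combination 2 * h
  have hpos : o ≠ -o ∧ -o - o ≠ -o ∧ 0 ≠ -o := by
    refine ⟨fun h => ho0 ?_, fun h => ho0 ?_, fun h => ho0 ?_⟩ <;>
      have h1 := congrArg Subtype.val h <;> push_cast at h1
    · linear_combination h1 / 2
    · linear_combination -h1
    · linear_combination h1
  obtain ⟨G₁, hG₁⟩ : ∃ G₁ : M → V, ∀ m, G₁ m = (ν + 1 / 2 * (m : F))⁻¹ • ⁅L M m, v⁆ :=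
    ⟨_, fun _ => rfl⟩
  have hG₁w : ∀ m : M, HasWeight M (ν + m) (G₁ m) := fun m => by rw [hG₁]; exact (hv.lie m).smul _
  have hG₁0 : ∀ m, m ≠ -o → G₁ m ≠ 0 := fun m hm => by
    rw [hG₁]; exact smul_ne_zero (inv_ne_zero (hcoef m hm)) (hne m hm)
  have hG₁z : G₁ 0 = v := by
    rw [hG₁, hv, smul_smul]
    simp [hν]
  obtain ⟨t, ht⟩ : ∃ t, t = β.formC (G₁ o) (G₁ (-o - o)) / β.formC v w := ⟨_, rfl⟩
  have ht0 : t ≠ 0 := by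
    rw [ht]
    exact div_ne_zero (hnd _ _ _ _ (hG₁w _) (hG₁w _) (hG₁0 _ hpos.1) (hG₁0 _ hpos.2.1)
      (by push_cast; rw [ho]; ring)) hvw
  obtain ⟨G, hG⟩ : ∃ G : M → V, G = Function.update G₁ (-o) (t • w) := ⟨_, rfl⟩
  have hGo : G (-o) = t • w := by rw [hG, Function.update_self]
  have hGm : ∀ m, m ≠ -o → G m = G₁ m := fun m hm => by rw [hG, Function.update_of_ne hm]
  have hGw : ∀ m : M, HasWeight M (ν + m) (G m) := by
    intro m
    by_cases hm : m = -o
    · rw [hm, hGo]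
      exact (hw.smul t).congr (by push_cast; rw [ho]; ring)
    · rw [hGm m hm]
      exact hG₁w m
  have hG0 : ∀ m, G m ≠ 0 := by
    intro m
    by_cases hm : m = -o
    · rw [hm, hGo]
      exact smul_ne_zero ht0 hw0
    · rw [hGm m hm]
      exact hG₁0 m hm
  have hex : ∀ m n, ∃ s : F, ⁅L M m, G n⁆ = s • G (n + m) := fun m n =>
    hV _ _ _ (hGw (n + m)) (((hGw n).lie m).congr (by push_cast; ring)) (hG0 _)
  choose f hf using hex
  have hfv : ∀ m, f m 0 = ν + 1 / 2 * (m : F) := by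
    intro m
    apply smul_left_injective F (hG0 m)
    have h := hf m 0
    rw [zero_add, hGm 0 hpos.2.2, hG₁z] at h
    change f m 0 • G m = _ • G m
    rw [← h]
    by_cases hm : m = -o
    · rw [hm, hann]
      push_cast
      rw [ho, show ν + 1 / 2 * -(2 * ν) = 0 by ring, zero_smul]
    · rw [hGm m hm, hG₁, smul_smul, mul_inv_cancel₀ (hcoef m hm), one_smul]
  have hmain := halfDensity_structureConstants (ι := scaledIndex M (o : F)) (o := o)
    (f := fun m n => f m n / o) (g := fun n => β.formC (G n) (G (-o - n))) ?_ ?_ ?_ ?_ ?_ ?_ ?_ ?_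
  · obtain ⟨h1, h2⟩ := hmain
    refine ⟨ν, β.formC (G 0) (G (-o)), G, h2ν, ?_, hGw, hG0, ?_, ?_, ?_⟩
    · exact hnd _ _ _ _ (hGw _) (hGw _) (hG0 _) (hG0 _) (by push_cast; rw [ho]; ring)
    · intro μ n
      rw [hf]
      congr 1
      have h := h2 μ n
      rw [scaledIndex_apply, scaledIndex_apply] at h
      field_simp at h
      rw [ho] at h
      linear_combination h / 2
    · exact fun m n => hL _ _ _ _ (hGw m) (hGw n)
    · intro m n hmn
      have h := h1 m
      have hn : n = -o - m := by
        apply Subtype.ext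
        push_cast
        rw [ho]
        linear_combination hmn
      simp only [sub_zero] at h
      rw [hn, h]
  · intro m n h
    rw [scaledIndex_apply, scaledIndex_apply] at h
    field_simp at h
    exact Subtype.ext h
  · rw [scaledIndex_apply, div_self ho0]
  · exact fun n => hnd _ _ _ _ (hGw _) (hGw _) (hG0 _) (hG0 _) (by push_cast; rw [ho]; ring)
  · intro n
    rw [β.formC_symm]
    congr 2
    abel
  · have h0 : -o - 0 = -o := by abel
    simp only [h0]
    rw [hGo, hGm 0 hpos.2.2, hGm o hpos.1, hGm (-o - o) hpos.2.1, hG₁z, formC_smul_right, ht,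
      div_mul_cancel₀ _ hvw]
  · intro m n
    have h := β.formC_lie (hGw n) (hGw (-o - m - n)) (μ := m) (by push_cast; rw [ho]; ring)
    rw [hL _ _ _ _ (hGw n) (hGw _), hf, hf, formC_smul_left, formC_smul_right, mul_zero,
      show -o - m - n + m = -o - n by abel, show -o - m - n = -o - (n + m) by abel] at h
    rw [show -o - m - n = -o - (n + m) by abel, add_comm m n]
    linear_combination h / (o : F)
  · intro m
    rw [hfv, scaledIndex_apply]
    field_simp
    rw [ho]
    ring
  · exact structureConstants_lie hc hG0 hf ho0

end OddBracket

end Vir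

/-! ### Odd brackets which involve the `L_μ` -/

namespace Vir

variable {F : Type*} [Field F] [CharZero F] {M : AddSubgroup F} {V : Type*} [AddCommGroup V]
  [Module F V] [LieRingModule (Vir M) V]

namespace OddBracket

variable {β : OddBracket M V} {ν : F} {v : V} {o : M}

theorem formL_lie_self (hv : HasWeight M ν v) (μ : M) :
    β.formL v ⁅L M μ, v⁆ = (ν - μ / 2) * β.formL v v := by
  have h := β.formL_lie hv hv μ
  rw [β.formL_symm ⁅L M μ, v⁆] at h
  linear_combination h / 2

theorem formL_lie_self_ne_zero (hv : HasWeight M ν v)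
    (hvv : β.formL v v ≠ 0) (ho : (o : F) = 2 * ν) {μ : M} (hμ : μ ≠ o) :
    β.formL v ⁅L M μ, v⁆ ≠ 0 := by
  rw [formL_lie_self hv]
  refine mul_ne_zero (fun h => hμ (Subtype.ext ?_)) hvv
  rw [ho]
  linear_combination -2 * h

/-- The coefficients of `c` in the brackets `[G_m, G_n]` follow from those of the `L_μ`. -/
theorem formC_of_formL {x : F} {G : M → V} (hν : ν ≠ 0)
    (hG : ∀ m : M, HasWeight M (ν + m) (G m))
    (hlie : ∀ μ n : M, ⁅L M μ, G n⁆ = (ν + n - 1 / 2 * μ) • G (n + μ))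
    (hx : ∀ m n, β.formL (G m) (G n) = x) {m n : M}
    (hmn : ν + m + (ν + n) = 0) :
    β.formC (G m) (G n) = -(x / 6) * ((ν + m) ^ 2 - 1 / 4) := by
  have key : ∀ a b μ : M, ν + a + (ν + b) + μ = 0 →
      (ν + a - 1 / 2 * μ) * β.formC (G (a + μ)) (G b) +
        (ν + b - 1 / 2 * μ) * β.formC (G a) (G (b + μ)) = ((μ : F) ^ 3 - μ) / 12 * x := by
    intro a b μ h
    have h1 := β.formC_lie (hG a) (hG b) h
    rwa [hlie, hlie, formC_smul_left, formC_smul_right, hx] at h1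
  have hdiag : ∀ a b : M, ν + a + (ν + b) = 0 → ν + (a : F) ≠ 0 →
      β.formC (G a) (G b) = -(x / 6) * ((ν + a) ^ 2 - 1 / 4) := by
    intro a b hab ha
    have h1 := key a a (b - a) (by push_cast; linear_combination hab)
    rw [add_sub_cancel, β.formC_symm (G b)] at h1
    push_cast at h1
    have hb : (b : F) = -2 * ν - a := by linear_combination hab
    rw [hb] at h1
    apply mul_left_cancel₀ (mul_ne_zero (show (4 : F) ≠ 0 by norm_num) ha)
    linear_combination h1
  -- For the weight `0` the diagonal relation is empty; `key` for the weights `ν` and `0` is used.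
  by_cases hm : ν + (m : F) = 0
  · have hn : n = m := Subtype.ext (by linear_combination hmn - 2 * hm)
    subst hn
    have ho' : (n : F) = -ν := by linear_combination hm
    have h1 := key 0 n n (by push_cast; rw [ho']; ring)
    have h2 := hdiag 0 (n + n) (by push_cast; rw [ho']; ring) (by simpa using hν)
    rw [zero_add, h2] at h1
    push_cast at h1
    rw [ho'] at h1 ⊢
    apply mul_left_cancel₀ hν
    linear_combination (2 / 3) * h1
  · exact hdiag m n hmn hm

variable [LieModule F (Vir M) V]

/-- The Jacobi identity of three odd weight vectors; the central terms do not contribute. -/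
theorem formL_smul_lie_add (hc : ∀ x : V, ⁅c M, x⁆ = 0) {l k j : F} {u w z : V}
    (hu : HasWeight M l u) (hw : HasWeight M k w) (hz : HasWeight M j z) {μ ν ρ : M}
    (hμ : l + k = μ) (hν : k + j = ν) (hρ : j + l = ρ) :
    β.formL u w • ⁅L M μ, z⁆ + β.formL w z • ⁅L M ν, u⁆ + β.formL z u • ⁅L M ρ, w⁆ = 0 := by
  have h := β.jacobi u w z
  rw [β.toLin_eq hu hw hμ, β.toLin_eq hw hz hν, β.toLin_eq hz hu hρ] at h
  simpa only [add_lie, smul_lie, hc, smul_zero, add_zero] using h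

theorem lie_eq_zero_of_formL_self_eq_zero (hV : WeightsSimple M V) {l k : F} {u w : V}
    (hu : HasWeight M l u) (hw : HasWeight M k w) (h0 : β.formL u u = 0) (h : β.formL u w ≠ 0)
    {δ : M} (hδ : k = l + δ) : ⁅L M δ, u⁆ = 0 := by
  have hw0 : w ≠ 0 := by
    rintro rfl
    exact h (β.formL_zero_right u)
  obtain ⟨t, ht⟩ := hV _ _ _ hw ((hu.lie δ).congr hδ.symm) hw0
  have h1 := β.formL_lie hu hu δ
  rw [β.formL_symm ⁅L M δ, u⁆, ht, formL_smul_right, h0, mul_zero, ← two_mul] at h1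
  have h2 : t = 0 := by simpa [h] using h1
  rw [ht, h2, zero_smul]

/-- Some weight vector has a nonzero square. If not, and `[u, w]` is not central, with `u` of nonzero
weight `l` and `w` of weight `l + δ`, then `L_δ`, `L_{2δ}` and `L_{3δ}` annihilate `u`. -/
theorem exists_formL_self_ne_zero [LieModule.IsIrreducible F (Vir M) V]
    (hV : WeightsSimple M V) (hc : ∀ x : V, ⁅c M, x⁆ = 0)
    (hL : ∃ (l k : F) (u w : V), HasWeight M l u ∧ HasWeight M k w ∧ β.formL u w ≠ 0) :
    ∃ (l : F) (v : V), HasWeight M l v ∧ β.formL v v ≠ 0 := by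
  by_contra! hself
  have key : ∀ (l k : F) (u w : V), HasWeight M l u → HasWeight M k w → l ≠ 0 →
      β.formL u w = 0 := by
    intro l k u w hu hw hl
    by_contra h
    have hu0 : u ≠ 0 := by
      rintro rfl
      exact h (β.formL_zero_left w)
    have hw0 : w ≠ 0 := by
      rintro rfl
      exact h (β.formL_zero_right u)
    obtain ⟨δ, hδ⟩ : ∃ δ : M, (δ : F) = k - l := ⟨⟨_, sub_mem_of_hasWeight hc hu hu0 hw hw0⟩, rfl⟩
    have hδ0 : δ ≠ 0 := by
      rintro rfl
      obtain ⟨t, rfl⟩ := hV l u w hu (hw.congr (by push_cast at hδ; linear_combination -hδ)) hu0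
      exact h (by rw [formL_smul_right, hself l u hu, mul_zero])
    have hδu : ⁅L M δ, u⁆ = 0 :=
      lie_eq_zero_of_formL_self_eq_zero hV hu hw (hself l u hu) h (by rw [hδ]; ring)
    have h2 : β.formL u ⁅L M δ, w⁆ ≠ 0 := by
      have h3 := β.formL_lie hu hw δ
      rw [hδu, formL_zero_left, zero_add, hδ, show l + k - (k - l) = 2 * l by ring] at h3
      rw [h3]
      exact mul_ne_zero (mul_ne_zero two_ne_zero hl) h
    have h2δu : ⁅L M (2 • δ), u⁆ = 0 :=
      lie_eq_zero_of_formL_self_eq_zero hV hu (hw.lie δ) (hself l u hu) h2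
        (by push_cast; rw [hδ, nsmul_eq_mul]; push_cast; ring)
    have h3δu : ⁅L M (3 • δ), u⁆ = 0 := by
      have h3 := lie_lie_comm hc (show δ + 2 • δ = 3 • δ by abel) u
      rw [h2δu, hδu, lie_zero, lie_zero, zero_add] at h3
      refine (smul_eq_zero.1 h3.symm).resolve_left ?_
      push_cast
      rw [nsmul_eq_mul]
      push_cast
      intro h4
      exact hδ0 (Subtype.ext (by push_cast; linear_combination h4))
    exact hu0 (eq_zero_of_highestWeight hc hV hu hl hδ0 hδu h2δu h3δu)
  obtain ⟨l, k, u, w, hu, hw, h⟩ := hL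
  by_cases hl : l = 0
  · by_cases hk : k = 0
    · have hu0 : u ≠ 0 := by
        rintro rfl
        exact h (β.formL_zero_left w)
      obtain ⟨t, rfl⟩ := hV l u w hu (hw.congr (by rw [hl, hk])) hu0
      exact h (by rw [formL_smul_right, hself l u hu, mul_zero])
    · exact h (by rw [β.formL_symm]; exact key k l w u hw hu hk)
  · exact h (key l k u w hu hw hl)

/-- The weight vector with nonzero square may be taken of nonzero weight: if `v` has weight `0`, then
`L_μ v` has a nonzero square for every nonzero weight `μ`. -/
theorem exists_formL_self_ne_zero_of_weight_ne_zero [LieModule.IsIrreducible F (Vir M) V]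
    (hspan : WeightsSpan M V) (hV : WeightsSimple M V) (hc : ∀ x : V, ⁅c M, x⁆ = 0)
    (htriv : ¬ LieModule.IsTrivial (Vir M) V)
    (hL : ∃ (l k : F) (u w : V), HasWeight M l u ∧ HasWeight M k w ∧ β.formL u w ≠ 0) :
    ∃ (l : F) (v : V), HasWeight M l v ∧ l ≠ 0 ∧ β.formL v v ≠ 0 := by
  obtain ⟨l, v, hv, hvv⟩ := exists_formL_self_ne_zero hV hc hL
  by_cases hl : l = 0
  · subst hl
    have hv0 : v ≠ 0 := by
      rintro rfl
      exact hvv (β.formL_zero_right _)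
    obtain ⟨ν, z, hz, hν, hz0⟩ := hspan.exists_weight_ne_zero hc htriv
    obtain ⟨μ, hμ⟩ : ∃ μ : M, (μ : F) = ν := by
      have h := sub_mem_of_hasWeight hc hv hv0 hz hz0
      rw [sub_zero] at h
      exact ⟨⟨ν, h⟩, rfl⟩
    have hμ0 : (μ : F) ≠ 0 := by rwa [hμ]
    obtain ⟨w, hw⟩ : ∃ w, w = ⁅L M μ, v⁆ := ⟨_, rfl⟩
    have hww : HasWeight M (μ : F) w := by
      rw [hw]
      exact (hv.lie μ).congr (zero_add _)
    refine ⟨μ, w, hww, hμ0, fun h => ?_⟩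
    have hvw : β.formL v w ≠ 0 := by
      have h1 := β.formL_lie hv hv μ
      rw [β.formL_symm ⁅L M μ, v⁆, ← hw] at h1
      intro h2
      rw [h2] at h1
      exact mul_ne_zero hμ0 hvv (by linear_combination h1)
    have h1 : ⁅L M μ, w⁆ = 0 := by
      have h2 := formL_smul_lie_add (β := β) hc hww hww hv (μ := μ + μ) (ν := μ) (ρ := μ)
        (by push_cast; rfl) (by ring) (by ring)
      rw [h, zero_smul, zero_add, β.formL_symm w v, ← add_smul] at h2
      refine (smul_eq_zero.1 h2).resolve_left ?_
      rw [← two_mul]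
      exact mul_ne_zero two_ne_zero hvw
    have h2 : ⁅L M (-μ), w⁆ = 0 :=
      lie_eq_zero_of_formL_self_eq_zero hV hww hv h (by rwa [β.formL_symm]) (by push_cast; ring)
    have h3 := lie_lie_comm hc (show -μ + μ = 0 by abel) w
    rw [h1, h2, lie_zero, lie_zero, zero_add, hww, smul_smul] at h3
    have hw0 : w = 0 := by
      refine (smul_eq_zero.1 h3.symm).resolve_left ?_
      push_cast
      rw [sub_neg_eq_add, ← two_mul]
      exact mul_ne_zero (mul_ne_zero two_ne_zero hμ0) hμ0
    exact hvw (by rw [hw0, formL_zero_right])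
  · exact ⟨l, v, hv, hl, hvv⟩

theorem lie_eq_zero_of_formL_self (hc : ∀ x : V, ⁅c M, x⁆ = 0) (hv : HasWeight M ν v)
    (hvv : β.formL v v ≠ 0) (ho : (o : F) = 2 * ν) : ⁅L M o, v⁆ = 0 := by
  have ho' : ν + ν = o := by rw [ho]; ring
  have h := formL_smul_lie_add (β := β) hc hv hv hv ho' ho' ho'
  rw [← add_smul, ← add_smul] at h
  refine (smul_eq_zero.1 h).resolve_left fun h1 => hvv ?_
  linear_combination h1 / 3

/-- The vector `L_μ v` pairs with `v` unless `μ = 2ν`; in the remaining weight space, the one of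
weight `3ν`, the vector `L_{4ν} L_{-2ν} v` pairs with `v`. -/
theorem exists_formL_ne_zero (hc : ∀ x : V, ⁅c M, x⁆ = 0)
    (hv : HasWeight M ν v) (hν : ν ≠ 0) (hvv : β.formL v v ≠ 0) (ho : (o : F) = 2 * ν) (m : M) :
    ∃ z : V, HasWeight M (ν + m) z ∧ β.formL v z ≠ 0 := by
  by_cases hm : m = o
  · subst hm
    have hm0 : (m : F) ≠ 0 := by rw [ho]; exact mul_ne_zero two_ne_zero hν
    have hne : ∀ k : ℤ, k ≠ 0 → k • m ≠ 0 := fun k hk h => by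
      have h1 := congrArg Subtype.val h
      push_cast at h1
      exact (mul_ne_zero (Int.cast_ne_zero.2 hk) hm0) (by simpa using h1)
    have hann := lie_eq_zero_of_formL_self hc hv hvv ho
    obtain ⟨w, hw⟩ : ∃ w, w = ⁅L M (-m), v⁆ := ⟨_, rfl⟩
    have hww : HasWeight M (-ν) w := by
      rw [hw]
      exact (hv.lie (-m)).congr (by push_cast; rw [ho]; ring)
    have hvw : β.formL v w ≠ 0 := by
      rw [hw]
      refine formL_lie_self_ne_zero hv hvv ho fun h => hne 2 two_ne_zero ?_
      rw [two_smul]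
      nth_rewrite 1 [← h]
      abel
    have hw0 : w ≠ 0 := by
      rintro rfl
      exact hvw (β.formL_zero_right _)
    have hwself : β.formL w w ≠ 0 := by
      intro h
      have h1 := formL_smul_lie_add (β := β) hc hww hww hv (μ := -m) (ν := 0) (ρ := 0)
        (by push_cast; rw [ho]; ring) (by push_cast; ring) (by push_cast; ring)
      rw [h, zero_smul, zero_add, β.formL_symm w v, ← add_smul, hww, smul_smul] at h1
      refine smul_ne_zero ?_ hw0 h1
      exact mul_ne_zero (by rw [← two_mul]; exact mul_ne_zero two_ne_zero hvw) (neg_ne_zero.2 hν)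
    have hwann : ⁅L M (-m), w⁆ = 0 :=
      lie_eq_zero_of_formL_self hc hww hwself (by push_cast; rw [ho]; ring)
    obtain ⟨u, hu⟩ : ∃ u, u = ⁅L M (m + m), w⁆ := ⟨_, rfl⟩
    have hu0 : u ≠ 0 := by
      intro h
      refine formL_lie_self_ne_zero hww hwself (o := -m) (by push_cast; rw [ho]; ring)
        (μ := m + m) (fun h => hne 3 three_ne_zero ?_) ?_
      · rw [show (3 : ℤ) • m = m + m + m by abel, h]
        abel
      · rw [← hu, h, formL_zero_right]
    have huw : HasWeight M (ν + m) u := by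
      rw [hu]
      exact (hww.lie (m + m)).congr (by push_cast; rw [ho]; ring)
    refine ⟨u, huw, fun h => hu0 ?_⟩
    have hmu : ⁅L M m, u⁆ = 0 := by
      have h1 := formL_smul_lie_add (β := β) hc hv hv huw (μ := m) (ν := m + m) (ρ := m + m)
        (by rw [ho]; ring) (by push_cast; rw [ho]; ring) (by push_cast; rw [ho]; ring)
      rw [β.formL_symm u v, h, zero_smul, add_zero, add_zero] at h1
      exact (smul_eq_zero.1 h1).resolve_left hvv
    -- Both `L_{2m} v` and `L_{3m} w` are mapped by `L_{-m}` to nonzero multiples of `u`.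
    have h1 := lie_lie_comm hc (show m + (m + m) = m + m + m by abel) w
    have h2 := lie_lie_comm hc (show m + -m = 0 by abel) v
    have h3 := lie_lie_comm hc (show -m + (m + m) = m by abel) v
    have h4 := lie_lie_comm hc (show -m + (m + m + m) = m + m by abel) w
    rw [← hw, hann, lie_zero, zero_add, hv, smul_smul] at h2
    rw [← hu, hmu, h2, lie_smul] at h1
    rw [← hw, ← hu, hann, smul_zero, add_zero] at h3
    rw [hwann, lie_zero, zero_add, ← hu] at h4
    have h5 := congrArg (fun z => ⁅L M (-m), z⁆) h1
    simp only [lie_zero, lie_add, lie_smul] at h5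
    rw [h3, h4, smul_smul, ← add_smul] at h5
    refine (smul_eq_zero.1 h5.symm).resolve_left ?_
    push_cast
    rw [show (-(m : F) - m) * ν + (m + m - m) * (m + m + m - -m) = -(m * (2 * ν)) + 4 * m * m
      by ring, ← ho, show -((m : F) * m) + 4 * m * m = 3 * (m * m) by ring]
    exact mul_ne_zero three_ne_zero (mul_ne_zero hm0 hm0)
  · exact ⟨_, hv.lie m, formL_lie_self_ne_zero hv hvv ho hm⟩

/-- If the odd bracket is not central, then there are weight vectors `G_m ≠ 0`, `m ∈ M`, which
satisfy the relations of `SVir`, up to a common factor in the brackets of the `G_m`. -/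
theorem exists_basis_of_not_central [LieModule.IsIrreducible F (Vir M) V]
    (hspan : WeightsSpan M V) (hV : WeightsSimple M V) (hβ : β.toLin ≠ 0)
    (htriv : ¬ LieModule.IsTrivial (Vir M) V)
    (hL : ∃ (l k : F) (u w : V), HasWeight M l u ∧ HasWeight M k w ∧ β.formL u w ≠ 0) :
    ∃ (ν x : F) (G : M → V), 2 * ν ∈ M ∧ x ≠ 0 ∧ (∀ m : M, HasWeight M (ν + m) (G m)) ∧
      (∀ m, G m ≠ 0) ∧ (∀ μ n : M, ⁅L M μ, G n⁆ = (ν + n - 1 / 2 * μ) • G (n + μ)) ∧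
      (∀ m n, β.formL (G m) (G n) = x) ∧
      ∀ m n : M, ν + m + (ν + n) = 0 →
        β.formC (G m) (G n) = -(x / 6) * ((ν + m) ^ 2 - 1 / 4) := by
  have hc := β.c_lie_eq_zero hspan hV hβ
  obtain ⟨ν, v, hv, hν, hvv⟩ := exists_formL_self_ne_zero_of_weight_ne_zero hspan hV hc htriv hL
  have h2ν : 2 * ν ∈ M := by
    rw [two_mul]
    exact β.mem_of_formL_ne_zero hv hv hvv
  obtain ⟨o, ho⟩ : ∃ o : M, (o : F) = 2 * ν := ⟨⟨2 * ν, h2ν⟩, rfl⟩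
  have ho0 : (o : F) ≠ 0 := by rw [ho]; exact mul_ne_zero two_ne_zero hν
  obtain ⟨x, hx⟩ : ∃ x, x = β.formL v v := ⟨_, rfl⟩
  rw [← hx] at hvv
  have hex : ∀ m : M, ∃ z : V, HasWeight M (ν + m) z ∧ β.formL v z = x ∧ (m = 0 → z = v) := by
    intro m
    by_cases hm : m = 0
    · subst hm
      exact ⟨v, hv.congr (by simp), hx.symm, fun _ => rfl⟩
    · obtain ⟨z, hz, hvz⟩ := exists_formL_ne_zero hc hv hν (hx ▸ hvv) ho m
      refine ⟨(x / β.formL v z) • z, hz.smul _, ?_, fun h => absurd h hm⟩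
      rw [formL_smul_right, div_mul_cancel₀ _ hvz]
  choose G hGw hGx hG0 using hex
  have hGv : G 0 = v := hG0 0 rfl
  have hG0 : ∀ m, G m ≠ 0 := by
    intro m h
    have h1 := hGx m
    rw [h, formL_zero_right] at h1
    exact hvv h1.symm
  have hex : ∀ m n, ∃ s : F, ⁅L M m, G n⁆ = s • G (n + m) := fun m n =>
    hV _ _ _ (hGw (n + m)) (((hGw n).lie m).congr (by push_cast; ring)) (hG0 _)
  choose f hf using hex
  have hder : ∀ m n k : M, f m n * β.formL (G (n + m)) (G k) + f m k * β.formL (G n) (G (k + m)) =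
      (ν + n + (ν + k) - m) * β.formL (G n) (G k) := by
    intro m n k
    have h := β.formL_lie (hGw n) (hGw k) m
    rwa [hf, hf, formL_smul_left, formL_smul_right] at h
  have hx0 : ∀ m, β.formL (G 0) (G m) = x := by
    intro m
    rw [hGv, hGx]
  have hf0 : ∀ m : M, f m 0 = ν - m / 2 := by
    intro m
    have h := hder m 0 0
    rw [β.formL_symm (G (0 + m)), hx0, hx0] at h
    push_cast at h
    apply mul_right_cancel₀ hvv
    linear_combination h / 2
  have hfy : ∀ m n, f m n * x = (2 * ν + n - m) * x - (ν - m / 2) * β.formL (G m) (G n) := by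
    intro m n
    have h := hder m n 0
    rw [hf0, zero_add, β.formL_symm (G (n + m)), hx0, β.formL_symm (G n) (G 0), hx0,
      β.formL_symm (G n)] at h
    push_cast at h
    linear_combination h
  have hone := superVirasoro_structureConstants_eq_one (ι := scaledIndex M (o : F)) (o := o)
    (f := fun m n => f m n / o) (y := fun m n => β.formL (G m) (G n) / x) ?_ ?_ ?_ ?_ ?_ ?_
  · have hGG : ∀ m n, β.formL (G m) (G n) = x := by
      intro m n
      have h := hone m n
      rwa [div_eq_one_iff_eq hvv] at h
    have hlie : ∀ μ n : M, ⁅L M μ, G n⁆ = (ν + n - 1 / 2 * μ) • G (n + μ) := by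
      intro μ n
      rw [hf]
      congr 1
      apply mul_right_cancel₀ hvv
      rw [hfy, hGG]
      ring
    exact ⟨ν, x, G, h2ν, hvv, hGw, hG0, hlie, hGG,
      fun m n hmn => formC_of_formL hν hGw hlie hGG hmn⟩
  · rw [scaledIndex_apply, div_self ho0]
  · intro m n
    rw [scaledIndex_apply, scaledIndex_apply]
    have h := hfy m n
    have h2 : 2 * ν = o := ho.symm
    field_simp
    have h3 : ν = o / 2 := by rw [ho]; ring
    rw [h3] at h
    linear_combination 2 * h
  · intro m n
    rw [β.formL_symm]
  · intro n
    rw [hx0, div_self hvv]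
  · intro m n k
    simp only [scaledIndex_apply]
    have h := hder m n k
    rw [add_comm m n, add_comm m k]
    have h3 : ν = o / 2 := by rw [ho]; ring
    rw [h3] at h
    field_simp
    linear_combination h
  · exact structureConstants_lie hc hG0 hf ho0

end OddBracket

end Vir

/-! ### Isomorphisms from homogeneous bases -/

namespace LieSuperalgebra

variable {F W : Type*} [Field F] [AddCommGroup W] [Module F W]

/-- A Lie superalgebra with a homogeneous basis is determined, up to isomorphism, by the parities
and the brackets of the elements of the basis. -/
theorem iso_ofBasis (S : LieSuperalgebra F W) {I : Type*} (b : Module.Basis I F W)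
    {p : I → ZMod 2} {br : I → I → I →₀ F} {hmem} {hskew} {hjac}
    (hp : ∀ i, b i ∈ S.part (p i))
    (hb : ∀ i j, S.bracket (b i) (b j) = Finsupp.linearCombination F b (br i j)) :
    S.Iso (ofBasis p br hmem hskew hjac) := by
  have hle : ∀ q : ZMod 2, ∀ f ∈ Finsupp.supported F F {k | p k = q},
      b.repr.symm f ∈ S.part q := by
    intro q f hf
    rw [Module.Basis.repr_symm_apply, Finsupp.linearCombination_apply]
    refine Submodule.sum_mem _ fun i hi => Submodule.smul_mem _ _ ?_
    have h : p i = q := (Finsupp.mem_supported F f).1 hf hi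
    exact h ▸ hp i
  refine ⟨b.repr, fun q x hx => ?_, fun x y => ?_⟩
  · -- The components of `x` in the basis vectors of parity `0` and `1` lie in the respective
    -- parts, so that the one of parity other than `q` vanishes.
    change b.repr x ∈ Finsupp.supported F F {k | p k = q}
    obtain ⟨f, hf, g, hg, hfg⟩ : ∃ f ∈ Finsupp.supported F F {k | p k = 0},
        ∃ g ∈ Finsupp.supported F F {k | p k = 1}, f + g = b.repr x := by
      have h := (ofBasis p br hmem hskew hjac).isCompl.sup_eq_top
      exact Submodule.mem_sup.1 (h ▸ Submodule.mem_top : b.repr x ∈ _)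
    have hx' : x = b.repr.symm f + b.repr.symm g := by
      rw [← map_add, hfg, LinearEquiv.symm_apply_apply]
    have hdisj := Submodule.disjoint_def.1 S.isCompl.disjoint
    rcases (by decide : ∀ q : ZMod 2, q = 0 ∨ q = 1) q with rfl | rfl
    · have h := hdisj (b.repr.symm g)
        (by rw [← sub_eq_iff_eq_add'.2 hx']; exact Submodule.sub_mem _ hx (hle 0 f hf))
        (hle 1 g hg)
      rw [← hfg, b.repr.symm.map_eq_zero_iff.1 h, add_zero]
      exact hf
    · have h := hdisj (b.repr.symm f) (hle 0 f hf)
        (by rw [← sub_eq_iff_eq_add.2 hx']; exact Submodule.sub_mem _ hx (hle 1 g hg))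
      rw [← hfg, b.repr.symm.map_eq_zero_iff.1 h, zero_add]
      exact hg
  · have h : S.bracket.compr₂ (b.repr : W →ₗ[F] I →₀ F) =
        (basisBracket br).compl₁₂ (b.repr : W →ₗ[F] I →₀ F) (b.repr : W →ₗ[F] I →₀ F) := by
      refine b.ext fun i => b.ext fun j => ?_
      simp [hb, basisBracket_single, ← Module.Basis.repr_symm_apply]
    exact LinearMap.congr_fun₂ h x y

end LieSuperalgebra

namespace Vir

variable {F : Type*} [Field F] {M : AddSubgroup F}

open Classical in
/-- The linear map with `L_μ ↦ a L_μ + δ_{μ,0} k c` and `c ↦ a' c`. -/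
noncomputable def shear (M : AddSubgroup F) (a a' k : F) : Vir M →ₗ[F] Vir M :=
  (basis M).constr F fun i => VirIndex.casesOn i
    (fun μ => a • L M μ + (if μ = 0 then k else 0) • c M) (a' • c M)

open Classical in
theorem shear_L (a a' k : F) (μ : M) :
    shear M a a' k (L M μ) = a • L M μ + (if μ = 0 then k else 0) • c M := by
  rw [← basis_L, shear, Module.Basis.constr_basis, basis_L]

theorem shear_c (a a' k : F) : shear M a a' k (c M) = a' • c M := by
  rw [← basis_c, shear, Module.Basis.constr_basis, basis_c]

theorem shear_comp_shear {a : F} (ha : a ≠ 0) (k : F) :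
    shear M a a⁻¹ k ∘ₗ shear M a⁻¹ a (-k) = LinearMap.id := by
  refine (basis M).ext fun i => ?_
  cases i with
  | L μ =>
    simp only [basis_L, LinearMap.comp_apply, shear_L, map_add, map_smul, shear_c, smul_add,
      smul_smul, LinearMap.id_apply, inv_mul_cancel₀ ha, one_smul, add_assoc, ← add_smul]
    split_ifs <;> simp [mul_comm]
  | c => simp [shear_c, smul_smul, ha]

/-- The basis of `Vir[M]` which consists of the `a L_μ + δ_{μ,0} k c` and `a⁻¹ c`. -/
noncomputable def shearBasis (M : AddSubgroup F) {a : F} (ha : a ≠ 0) (k : F) :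
    Module.Basis (VirIndex M) F (Vir M) :=
  (basis M).map (LinearEquiv.ofLinearMap (shear M a a⁻¹ k) (shear M a⁻¹ a (-k))
    (shear_comp_shear ha k) (by
      have h := shear_comp_shear (M := M) (inv_ne_zero ha) (-k)
      rwa [inv_inv, neg_neg] at h))

open Classical in
theorem shearBasis_L {a : F} (ha : a ≠ 0) (k : F) (μ : M) :
    shearBasis M ha k (.L μ) = a • L M μ + (if μ = 0 then k else 0) • c M := by
  simp [shearBasis, shear_L]

theorem shearBasis_c {a : F} (ha : a ≠ 0) (k : F) : shearBasis M ha k .c = a⁻¹ • c M := by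
  simp [shearBasis, shear_c]

end Vir

theorem mul_mem_scaleSubgroup {F : Type*} [Field F] {M : AddSubgroup F} (a : F) {m : F}
    (hm : m ∈ M) : a * m ∈ scaleSubgroup a M :=
  ⟨m, hm, rfl⟩

theorem scaleSubgroup_one {F : Type*} [Field F] (M : AddSubgroup F) : scaleSubgroup 1 M = M := by
  ext x
  simp [scaleSubgroup, AddSubgroup.mem_map]

namespace SVirIndex

variable {F : Type*} [Field F]

/-- The bijection between the index sets for `M`, `ν` and `aM`, `aν`, where an odd index `ν + m` is
given by `m ∈ M`. -/
def scale (M : AddSubgroup F) (a ν : F) : VirIndex M ⊕ M → SVirIndex (scaleSubgroup a M) (a * ν)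
  | .inl (.L μ) => .L ⟨a * μ, mul_mem_scaleSubgroup a μ.2⟩
  | .inl .c => .c
  | .inr m => .G ⟨a * (ν + m), by
      rw [mul_add, add_sub_cancel_left]
      exact mul_mem_scaleSubgroup a m.2⟩

theorem scale_bijective (M : AddSubgroup F) {a : F} (ha : a ≠ 0) (ν : F) :
    Function.Bijective (scale M a ν) := by
  constructor
  · rintro ((μ | _) | m) ((μ' | _) | m') h <;>
      simp only [scale, SVirIndex.L.injEq, SVirIndex.G.injEq, Subtype.mk.injEq, mul_eq_mul_left_iff,
        ha, or_false, add_right_inj, reduceCtorEq] at h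
    · rw [Subtype.ext h]
    · rfl
    · rw [Subtype.ext h]
  · rintro (⟨μ, m, hm, rfl⟩ | _ | ⟨κ, m, hm, h⟩)
    · exact ⟨.inl (.L ⟨m, hm⟩), rfl⟩
    · exact ⟨.inl .c, rfl⟩
    · refine ⟨.inr ⟨m, hm⟩, congrArg SVirIndex.G (Subtype.ext ?_)⟩
      change a * m = κ - a * ν at h
      linear_combination h

end SVirIndex

/-! ### Lie superalgebras with even part `Vir[M]` -/

namespace LieSuperalgebra

variable {F W : Type*} [Field F] [CharZero F] [AddCommGroup W] [Module F W]
  {M : AddSubgroup F} (S : LieSuperalgebra F W) (e : Vir M ≃ₗ⁅F⁆ S.part 0)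

/-- The even part of `S`, as the image of `Vir[M]`. -/
noncomputable def evenVal : Vir M →ₗ[F] W := (S.part 0).subtype ∘ₗ (e : Vir M →ₗ[F] S.part 0)

/-- The inclusion of the odd part. -/
def oddVal : S.OddModule e →ₗ[F] W := (S.part 1).subtype

variable {S e}

theorem evenVal_mem (X : Vir M) : S.evenVal e X ∈ S.part 0 := (e X).2

theorem oddVal_mem (v : S.OddModule e) : S.oddVal e v ∈ S.part 1 :=
  Subtype.property (p := (· ∈ S.part 1)) v

theorem oddVal_injective : Function.Injective (S.oddVal e) := (S.part 1).injective_subtype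

theorem evenVal_injective : Function.Injective (S.evenVal e) :=
  (S.part 0).injective_subtype.comp e.injective

theorem bracket_evenVal (X Y : Vir M) :
    S.bracket (S.evenVal e X) (S.evenVal e Y) = S.evenVal e ⁅X, Y⁆ :=
  (congrArg Subtype.val (e.map_lie X Y)).symm

theorem bracket_evenVal_oddVal (X : Vir M) (v : S.OddModule e) :
    S.bracket (S.evenVal e X) (S.oddVal e v) = S.oddVal e ⁅X, v⁆ := rfl

theorem bracket_oddVal_evenVal (X : Vir M) (v : S.OddModule e) :
    S.bracket (S.oddVal e v) (S.evenVal e X) = -S.oddVal e ⁅X, v⁆ := by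
  have h := S.skew 1 0 _ _ (oddVal_mem v) (evenVal_mem (e := e) X)
  rwa [ZMod.val_zero, mul_zero, pow_zero, one_smul, bracket_evenVal_oddVal] at h

theorem bracket_oddVal_comm (u v : S.OddModule e) :
    S.bracket (S.oddVal e u) (S.oddVal e v) = S.bracket (S.oddVal e v) (S.oddVal e u) := by
  have h := S.skew 1 1 _ _ (oddVal_mem u) (oddVal_mem v)
  have h1 : (1 : ZMod 2).val = 1 := rfl
  rwa [h1, mul_one, pow_one, neg_smul, one_smul, neg_neg] at h

variable (S e) in
/-- A basis of `W` from a basis of `Vir[M]` and a basis of the odd part. -/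
noncomputable def sumBasis {I J : Type*} (b : Module.Basis I F (Vir M))
    (b' : Module.Basis J F (S.OddModule e)) : Module.Basis (I ⊕ J) F W :=
  ((b.map (e : Vir M ≃ₗ[F] S.part 0)).prod
    (b'.map (LinearEquiv.refl F (S.part 1) : S.OddModule e ≃ₗ[F] S.part 1))).map
    (Submodule.prodEquivOfIsCompl (S.part 0) (S.part 1) S.isCompl)

theorem sumBasis_inl {I J : Type*} (b : Module.Basis I F (Vir M))
    (b' : Module.Basis J F (S.OddModule e)) (i : I) :
    sumBasis S e b b' (.inl i) = S.evenVal e (b i) := by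
  rw [sumBasis, Module.Basis.map_apply, Module.Basis.prod_apply]
  simp [evenVal]

theorem sumBasis_inr {I J : Type*} (b : Module.Basis I F (Vir M))
    (b' : Module.Basis J F (S.OddModule e)) (j : J) :
    sumBasis S e b b' (.inr j) = S.oddVal e (b' j) := by
  rw [sumBasis, Module.Basis.map_apply, Module.Basis.prod_apply]
  simp [oddVal]
  rfl

open Vir in
/-- The Lie superalgebra `S` is recognized from a basis `G_m`, `m ∈ M`, of its odd part, and the
indices may be scaled by any `a ≠ 0`: the elements `a L_μ - δ_{μ,0} (a⁻¹ - a)/24 c` and `a⁻¹ c`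
satisfy the relations of `L_{aμ}` and `c` in `Vir[aM]`. -/
theorem iso_ofParameters {a s ν b x x' : F} {y y' : F → F} (ha : a ≠ 0) (hs : s ≠ 0)
    (hν : 2 * ν ∈ M) (hc : ∀ v : S.OddModule e, ⁅c M, v⁆ = 0)
    (G : Module.Basis M F (S.OddModule e))
    (hG : ∀ μ n : M, ⁅L M μ, G n⁆ = (ν + n + b * μ) • G (n + μ))
    (hGG : ∀ m n o : M, (o : F) = ν + m + (ν + n) → ν + m + (ν + n) ≠ 0 →
      S.bracket (S.oddVal e (G m)) (S.oddVal e (G n)) = S.evenVal e (x • L M o))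
    (hGG0 : ∀ m n : M, ν + m + (ν + n) = 0 →
      S.bracket (S.oddVal e (G m)) (S.oddVal e (G n)) =
        S.evenVal e (x • L M 0 + y (ν + m) • c M))
    (hxx' : s ^ 2 * x = x' * a)
    (hyy' : ∀ κ, s ^ 2 * y κ = y' (a * κ) * a⁻¹ - x' * ((a⁻¹ - a) / 24))
    (hα : 2 * (a * ν) ∈ scaleSubgroup a M) {hy hx hxy} :
    S.Iso (SVir.ofParameters hα b x' y' hy hx hxy) := by
  classical
  obtain ⟨k, hk⟩ : ∃ k, k = -((a⁻¹ - a) / 24) := ⟨_, rfl⟩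
  let σ := Equiv.ofBijective _ (SVirIndex.scale_bijective M ha ν)
  let B := (sumBasis S e (shearBasis M ha k) (G.isUnitSMul (w := fun _ => s) fun _ => hs.isUnit))
  have hBL : ∀ μ, B (.inl (.L μ)) =
      S.evenVal e (a • L M μ + (if μ = 0 then k else 0) • Vir.c M) := fun μ => by
    rw [sumBasis_inl, shearBasis_L]
  have hBc : B (.inl .c) = S.evenVal e (a⁻¹ • Vir.c M) := by
    rw [sumBasis_inl, shearBasis_c]
  have hBG : ∀ m, B (.inr m) = S.oddVal e (s • G m) := fun m => by
    rw [sumBasis_inr, Module.Basis.isUnitSMul_apply]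
  have hB : ∀ j, (B.reindex σ) (SVirIndex.scale M a ν j) = B j := fun j => by
    rw [Module.Basis.reindex_apply]
    exact congrArg B (σ.symm_apply_apply j)
  refine S.iso_ofBasis (B.reindex σ) ?_ ?_
  · intro i
    obtain ⟨j, rfl⟩ := (SVirIndex.scale_bijective M ha ν).2 i
    rw [hB]
    rcases j with ((μ | _) | m)
    · rw [hBL]; exact evenVal_mem _
    · rw [hBc]; exact evenVal_mem _
    · rw [hBG]; exact oddVal_mem _
  · intro i j
    obtain ⟨i, rfl⟩ := (SVirIndex.scale_bijective M ha ν).2 i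
    obtain ⟨j, rfl⟩ := (SVirIndex.scale_bijective M ha ν).2 j
    rw [hB, hB]
    have hcomb : ∀ (i' j' : VirIndex M ⊕ M) (t t' : F), Finsupp.linearCombination F (B.reindex σ)
        (Finsupp.single (SVirIndex.scale M a ν i') t + Finsupp.single (SVirIndex.scale M a ν j') t')
        = t • B i' + t' • B j' := by
      intro i' j' t t'
      simp only [map_add, Finsupp.linearCombination_single, hB]
    have hcomb1 : ∀ (i' : VirIndex M ⊕ M) (t : F), Finsupp.linearCombination F (B.reindex σ)
        (Finsupp.single (SVirIndex.scale M a ν i') t) = t • B i' := by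
      intro i' t
      rw [Finsupp.linearCombination_single, hB]
    have hLG : ∀ μ m, ⁅a • L M μ + (if μ = 0 then k else 0) • Vir.c M, s • G m⁆ =
        (a * (ν + m) + b * (a * μ)) • s • G (m + μ) := by
      intro μ m
      simp only [add_lie, smul_lie, lie_smul, hc, hG, smul_zero, add_zero, smul_smul]
      congr 1
      ring
    have haddG : ∀ (μ m : M) (h h'), SVirIndex.G (SVir.addG (α := a * ν)
        (⟨a * μ, h⟩ : scaleSubgroup a M) ⟨a * (ν + m), h'⟩) =
        SVirIndex.scale M a ν (.inr (m + μ)) := by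
      intro μ m h h'
      refine congrArg SVirIndex.G (Subtype.ext ?_)
      change a * (μ : F) + a * (ν + m) = a * (ν + ((m + μ : M) : F))
      push_cast
      ring
    rcases i with ((μ | _) | m) <;> rcases j with ((μ' | _) | m')
    · rw [hBL, hBL, bracket_evenVal]
      have h : SVirIndex.L ((⟨a * μ, mul_mem_scaleSubgroup a μ.2⟩ : scaleSubgroup a M) +
          ⟨a * μ', mul_mem_scaleSubgroup a μ'.2⟩) =
          SVirIndex.scale M a ν (.inl (.L (μ + μ'))) :=
        congrArg SVirIndex.L (Subtype.ext (mul_add a (μ : F) μ').symm)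
      change _ = Finsupp.linearCombination F _ (Finsupp.single (SVirIndex.L _) _ +
        Finsupp.single (SVirIndex.scale M a ν (.inl .c)) _)
      rw [h, hcomb, hBL, hBc, ← map_smul, ← map_smul, ← map_add]
      congr 1
      have h0 : a * (μ : F) + a * μ' = 0 ↔ μ + μ' = 0 := by
        rw [← mul_add, mul_eq_zero, or_iff_right ha, ← ZeroMemClass.coe_eq_zero,
          AddSubgroup.coe_add]
      simp only [add_lie, smul_lie, lie_add, lie_smul, c_lie, lie_c, smul_zero, add_zero,
        lie_L_L, h0]
      by_cases hμ : μ + μ' = 0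
      · have hμ' : (μ' : F) = -μ := by
          have h1 := congrArg Subtype.val hμ
          push_cast at h1
          linear_combination h1
        simp only [if_pos hμ, hμ']
        match_scalars
        · ring
        · rw [hk]
          field_simp
          ring
      · simp only [if_neg hμ]
        match_scalars <;> ring
    · rw [hBL, hBc, bracket_evenVal, lie_smul, lie_c, smul_zero, map_zero]
      exact (map_zero _).symm
    · rw [hBL, hBG, bracket_evenVal_oddVal, hLG]
      change _ = Finsupp.linearCombination F _ (Finsupp.single (SVirIndex.G (SVir.addG _ _)) _)
      rw [haddG, hcomb1, hBG, map_smul]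
    · rw [hBL, hBc, bracket_evenVal, smul_lie, c_lie, smul_zero, map_zero]
      exact (map_zero _).symm
    · rw [hBc, bracket_evenVal, smul_lie, c_lie, smul_zero, map_zero]
      exact (map_zero _).symm
    · rw [hBc, hBG, bracket_evenVal_oddVal, smul_lie, hc, smul_zero, map_zero]
      exact (map_zero _).symm
    · rw [hBL, hBG, bracket_oddVal_evenVal, hLG]
      change _ = Finsupp.linearCombination F _ (Finsupp.single (SVirIndex.G (SVir.addG _ _)) _)
      rw [haddG, hcomb1, hBG, map_smul, neg_smul]
    · rw [hBc, hBG, bracket_oddVal_evenVal, smul_lie, hc, smul_zero, map_zero, neg_zero]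
      exact (map_zero _).symm
    · have hsG : S.bracket (B (.inr m)) (B (.inr m')) =
          s ^ 2 • S.bracket (S.oddVal e (G m)) (S.oddVal e (G m')) := by
        rw [hBG, hBG, map_smul, map_smul, map_smul, map_smul, LinearMap.smul_apply, smul_smul, sq]
      obtain ⟨o, ho⟩ : ∃ o : M, (o : F) = ν + m + (ν + m') :=
        ⟨⟨2 * ν, hν⟩ + m + m', by push_cast; ring⟩
      have h : SVirIndex.L (SVir.addGG hα (⟨a * (ν + m), by
            rw [mul_add, add_sub_cancel_left]
            exact mul_mem_scaleSubgroup a m.2⟩) ⟨a * (ν + m'), by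
            rw [mul_add, add_sub_cancel_left]
            exact mul_mem_scaleSubgroup a m'.2⟩) =
          SVirIndex.scale M a ν (.inl (.L o)) := by
        refine congrArg SVirIndex.L (Subtype.ext ?_)
        change a * (ν + m) + a * (ν + m') = a * (o : F)
        rw [ho]
        ring
      change _ = Finsupp.linearCombination F _ (Finsupp.single (SVirIndex.L (SVir.addGG hα _ _)) _ +
        Finsupp.single (SVirIndex.scale M a ν (.inl .c)) _)
      rw [h, hcomb, hBL, hBc, hsG]
      have h0 : a * (ν + m) + a * (ν + m') = 0 ↔ o = 0 := by
        rw [← mul_add, mul_eq_zero, or_iff_right ha, ← ho, ZeroMemClass.coe_eq_zero]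
      by_cases ho0 : o = 0
      · rw [hGG0 m m' (by rw [← ho, ho0]; rfl)]
        simp only [h0, ho0, if_true, ← map_smul, ← map_add]
        congr 1
        match_scalars
        · linear_combination hxx'
        · rw [hk]
          linear_combination hyy' (ν + m)
      · rw [hGG m m' o ho (by rw [← ho]; exact fun h => ho0 (Subtype.ext h))]
        simp only [h0, ho0, if_false, ← map_smul, ← map_add]
        congr 1
        match_scalars
        · linear_combination hxx'
        · ring

end LieSuperalgebra

/-! ### The classification -/

namespace Vir

variable {F : Type*} [Field F] [CharZero F] {M : AddSubgroup F} {V : Type*} [AddCommGroup V]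
  [Module F V] [LieRingModule (Vir M) V] [LieModule F (Vir M) V]

theorem exists_basis_coe_eq [LieModule.IsIrreducible F (Vir M) V] (hc : ∀ x : V, ⁅c M, x⁆ = 0)
    {ν : F} {G : M → V} (hG : ∀ m : M, HasWeight M (ν + m) (G m)) (hG0 : ∀ m, G m ≠ 0)
    {f : M → M → F} (hf : ∀ μ n, ⁅L M μ, G n⁆ = f μ n • G (n + μ)) :
    ∃ b : Module.Basis M F V, ⇑b = G := by
  have hli : LinearIndependent F G :=
    Module.End.eigenvectors_linearIndependent' (LieModule.toEnd F (Vir M) V (L M 0))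
      (fun m : M => ν + m) (fun m n h => Subtype.ext (add_left_cancel h)) G
      fun m => ⟨hasWeight_iff.1 (hG m), hG0 m⟩
  have htop : Submodule.span F (Set.range G) = ⊤ := by
    apply eq_top_of_lie_mem (M := M)
    · intro X x hx
      refine lie_mem_of_basis ?_ (fun z _ => by rw [hc]; exact Submodule.zero_mem _) X hx
      intro μ x hx
      induction hx using Submodule.span_induction with
      | mem x hx =>
        obtain ⟨n, rfl⟩ := hx
        rw [hf]
        exact Submodule.smul_mem _ _ (Submodule.subset_span ⟨_, rfl⟩)
      | zero => rw [lie_zero]; exact Submodule.zero_mem _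
      | add x y _ _ hx hy => rw [lie_add]; exact Submodule.add_mem _ hx hy
      | smul t x _ hx => rw [lie_smul]; exact Submodule.smul_mem _ t hx
    · intro h
      apply hG0 0
      rw [← Submodule.mem_bot F, ← h]
      exact Submodule.subset_span ⟨_, rfl⟩
  exact ⟨Module.Basis.mk hli htop.ge, Module.Basis.coe_mk _ _⟩

theorem _root_.IsIntermediateSeries.weightsSimple (h : IsIntermediateSeries M V) :
    WeightsSimple M V := by
  intro l x y hx hy hx0
  obtain ⟨z, hz⟩ := rank_le_one_iff.1 (h.rank_weight l)
  obtain ⟨r, hr⟩ := hz ⟨x, hasWeight_iff.1 hx⟩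
  obtain ⟨t, ht⟩ := hz ⟨y, hasWeight_iff.1 hy⟩
  have hr' : r • (z : V) = x := congrArg Subtype.val hr
  have ht' : t • (z : V) = y := congrArg Subtype.val ht
  have hr0 : r ≠ 0 := by
    rintro rfl
    exact hx0 (by rw [← hr', zero_smul])
  refine ⟨t / r, ?_⟩
  rw [← hr', smul_smul, div_mul_cancel₀ _ hr0, ht']

end Vir

namespace LieSuperalgebra

open Vir

variable {F W : Type*} [Field F] [CharZero F] [AddCommGroup W] [Module F W]
  {M : AddSubgroup F} (S : LieSuperalgebra F W) (e : Vir M ≃ₗ⁅F⁆ S.part 0)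

theorem evenVal_symm {x : W} (hx : x ∈ S.part 0) : S.evenVal e (e.symm ⟨x, hx⟩) = x :=
  congrArg Subtype.val (e.apply_symm_apply ⟨x, hx⟩)

theorem bracket_oddVal_mem (u w : S.OddModule e) :
    S.bracket (S.oddVal e u) (S.oddVal e w) ∈ S.part 0 :=
  S.bracket_mem 1 1 _ _ (oddVal_mem u) (oddVal_mem w)

/-- The bracket of two odd elements, as an element of `Vir[M]`. -/
noncomputable def oddBracket : OddBracket M (S.OddModule e) where
  toLin := LinearMap.mk₂ F (fun u w => e.symm ⟨_, S.bracket_oddVal_mem e u w⟩)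
    (fun u u' w => evenVal_injective (S := S) (e := e) (by
      simp only [map_add, evenVal_symm, LinearMap.add_apply]))
    (fun t u w => evenVal_injective (S := S) (e := e) (by
      simp only [map_smul, evenVal_symm, LinearMap.smul_apply]))
    (fun u w w' => evenVal_injective (S := S) (e := e) (by simp only [map_add, evenVal_symm]))
    (fun t u w => evenVal_injective (S := S) (e := e) (by simp only [map_smul, evenVal_symm]))
  symm u w := evenVal_injective (S := S) (e := e) (by
    simp only [LinearMap.mk₂_apply, evenVal_symm]
    exact bracket_oddVal_comm u w)
  lie X u w := evenVal_injective (S := S) (e := e) (by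
    simp only [LinearMap.mk₂_apply, evenVal_symm, map_add, ← bracket_evenVal,
      ← bracket_evenVal_oddVal]
    have h := S.jacobi 0 1 _ _ (S.oddVal e w) (evenVal_mem (e := e) X) (oddVal_mem u)
    rwa [ZMod.val_zero, zero_mul, pow_zero, one_smul] at h)
  jacobi u w z := oddVal_injective (S := S) (e := e) (by
    simp only [LinearMap.mk₂_apply, evenVal_symm, map_add, ← bracket_evenVal_oddVal, map_zero]
    have h1 : (1 : ZMod 2).val = 1 := rfl
    have hs : ∀ u w z : S.OddModule e,
        S.bracket (S.oddVal e u) (S.bracket (S.oddVal e w) (S.oddVal e z)) =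
          -S.bracket (S.bracket (S.oddVal e w) (S.oddVal e z)) (S.oddVal e u) := by
      intro u w z
      have h := S.skew 1 0 _ _ (oddVal_mem u) (S.bracket_oddVal_mem e w z)
      rwa [ZMod.val_zero, mul_zero, pow_zero, one_smul] at h
    have h := S.jacobi 1 1 _ _ (S.oddVal e z) (oddVal_mem u) (oddVal_mem w)
    rw [h1, mul_one, pow_one, neg_smul, one_smul, hs, hs, bracket_oddVal_comm u z, neg_neg] at h
    rw [add_right_comm, ← h, neg_add_cancel])

theorem evenVal_oddBracket (u w : S.OddModule e) :
    S.evenVal e ((S.oddBracket e).toLin u w) = S.bracket (S.oddVal e u) (S.oddVal e w) :=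
  S.evenVal_symm e (S.bracket_oddVal_mem e u w)

/-- Rescaling the odd elements by `s` multiplies their brackets by `s²`; a factor which is not a
square is left to be absorbed by a scaling of the indices. -/
theorem exists_sq_mul_eq {x : F} (hx : x ≠ 0) :
    ∃ a s : F, a ≠ 0 ∧ s ≠ 0 ∧ s ^ 2 * x = a ∧ (a = 1 ∨ ¬ IsSquare a) := by
  by_cases h : IsSquare x
  · obtain ⟨t, rfl⟩ := h
    have ht : t ≠ 0 := left_ne_zero_of_mul hx
    refine ⟨1, t⁻¹, one_ne_zero, inv_ne_zero ht, ?_, Or.inl rfl⟩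
    field_simp
  · exact ⟨x, 1, hx, one_ne_zero, by ring, Or.inr h⟩

end LieSuperalgebra

open LieSuperalgebra Vir in
theorem lemma5p1 {F W : Type*} [Field F] [CharZero F] [AddCommGroup W] [Module F W]
    (M : AddSubgroup F) (S : LieSuperalgebra F W)
    (e : Vir M ≃ₗ⁅F⁆ S.part 0)
    (hseries : IsIntermediateSeries M (S.OddModule e))
    (hirr : LieModule.IsIrreducible F (Vir M) (S.OddModule e))
    (htriv : ¬ LieModule.IsTrivial (Vir M) (S.OddModule e))
    (hext : ∃ x ∈ S.part 1, ∃ y ∈ S.part 1, S.bracket x y ≠ 0) :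
    ∃ (M' : AddSubgroup F) (α : F) (hα : 2 * α ∈ M'),
      (M' = M ∨ ∃ a : F, ¬ IsSquare a ∧ M' = scaleSubgroup a M) ∧
      (S.Iso (SVirTilde M' α hα) ∨ S.Iso (SVir M' α hα)) := by
  have hspan : WeightsSpan M (S.OddModule e) := hseries.iSup_weight
  have hV := hseries.weightsSimple
  obtain ⟨β, hβ⟩ : ∃ β, β = S.oddBracket e := ⟨_, rfl⟩
  have hβe : ∀ u w, S.bracket (S.oddVal e u) (S.oddVal e w) = S.evenVal e (β.toLin u w) := by
    intro u w
    rw [hβ, evenVal_oddBracket]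
  have hβ0 : β.toLin ≠ 0 := by
    intro h
    obtain ⟨x, hx, y, hy, hxy⟩ := hext
    obtain ⟨u, rfl⟩ : ∃ u : S.OddModule e, S.oddVal e u = x := ⟨(⟨x, hx⟩ : S.part 1), rfl⟩
    obtain ⟨w, rfl⟩ : ∃ w : S.OddModule e, S.oddVal e w = y := ⟨(⟨y, hy⟩ : S.part 1), rfl⟩
    have h1 := hβe u w
    rw [h, LinearMap.zero_apply, LinearMap.zero_apply, map_zero] at h1
    exact hxy h1
  have hc := β.c_lie_eq_zero hspan hV hβ0
  have hscale : ∀ {a ν : F}, 2 * ν ∈ M → 2 * (a * ν) ∈ scaleSubgroup a M := by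
    intro a ν h
    rw [mul_left_comm]
    exact mul_mem_scaleSubgroup a h
  have hM' : ∀ {a : F}, (a = 1 ∨ ¬ IsSquare a) →
      scaleSubgroup a M = M ∨ ∃ b : F, ¬ IsSquare b ∧ scaleSubgroup a M = scaleSubgroup b M := by
    rintro a (rfl | h)
    · exact Or.inl (scaleSubgroup_one M)
    · exact Or.inr ⟨a, h, rfl⟩
  by_cases hL : ∀ (l k : F) (u w : S.OddModule e), HasWeight M l u → HasWeight M k w →
      β.formL u w = 0
  -- With the indices scaled by `a⁻¹`, the central element is `a c`.
  · obtain ⟨ν, g, G, hν, hg, hGw, hG0, hlie, hGL, hGC⟩ :=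
      OddBracket.exists_basis_of_central hspan hV hβ0 htriv hL
    obtain ⟨b, rfl⟩ := exists_basis_coe_eq hc hGw hG0 hlie
    obtain ⟨a, s, ha, hs, hsg, ha'⟩ := exists_sq_mul_eq hg
    refine ⟨scaleSubgroup a⁻¹ M, a⁻¹ * ν, hscale hν, hM' ?_, Or.inl ?_⟩
    · rwa [inv_eq_one, isSquare_inv]
    · refine iso_ofParameters (s := s) (x := 0) (y := fun _ => g) (inv_ne_zero ha) hs hν hc b hlie
        ?_ ?_ ?_ ?_ _
      · intro m n o ho h
        rw [hβe, β.toLin_eq (hGw m) (hGw n) ho.symm, hGL, β.formC_eq_zero (hGw m) (hGw n) h,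
          zero_smul _ (c M), add_zero]
      · intro m n h
        rw [hβe, β.toLin_eq (hGw m) (hGw n) (m := 0) h, hGL, hGC m n h]
      · ring
      · intro κ
        rw [hsg, inv_inv]
        ring
  · push Not at hL
    obtain ⟨ν, x, G, hν, hx, hGw, hG0, hlie, hGL, hGC⟩ :=
      OddBracket.exists_basis_of_not_central hspan hV hβ0 htriv hL
    obtain ⟨b, rfl⟩ := exists_basis_coe_eq hc hGw hG0 hlie
    obtain ⟨a, s, ha, hs, hsx, ha'⟩ := exists_sq_mul_eq (div_ne_zero hx two_ne_zero)
    refine ⟨scaleSubgroup a M, a * ν, hscale hν, hM' ha', Or.inr ?_⟩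
    have hsx' : s ^ 2 * x = 2 * a := by linear_combination 2 * hsx
    refine iso_ofParameters (s := s) (x := x) (y := fun κ => -(x / 6) * (κ ^ 2 - 1 / 4)) ha hs hν hc
      b ?_ ?_ ?_ hsx' ?_ _
    · intro μ n
      rw [hlie]
      congr 1
      ring
    · intro m n o ho h
      rw [hβe, β.toLin_eq (hGw m) (hGw n) ho.symm, hGL, β.formC_eq_zero (hGw m) (hGw n) h,
        zero_smul, add_zero]
    · intro m n h
      rw [hβe, β.toLin_eq (hGw m) (hGw n) (m := 0) h, hGL, hGC m n h]
    · intro κ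
      field_simp
      linear_combination 72 * (1 - 4 * κ ^ 2) * a * hsx'
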